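/- Let $g \ge 0$ and $p \ge 1$ be integers, and let $$\pi_1(\Sigma_{g,p}) = \langle a_1,\dots,a_g,\, b_1,\dots,b_g,\, c_1,\dots,c_p \mid [a_1,b_1]\cdots[a_g,b_g]\, c_1\cdots c_p = 1\rangle$$ be the fundamental group of the surface of genus $g$ with $p$ punctures, where $c_1,\dots,c_p$ are the loops around the punctures. Call an element of $\mathrm{SL}_3(\mathbb{R})$ parabolic if it is conjugate to $\begin{pmatrix}1&1&0\\0&1&1\\0&0&1\end{pmatrix}$. Let $\mathrm{Hom}_P^{irr}$ be the set of the representations $\rho : \pi_1(\Sigma_{g,p}) \to \mathrm{SL}_3(\mathbb{R})$ that are irreducible on $\mathbb{R}^3$ and for which $\rho(c_1),\dots,\rho(c_p)$ are all parabolic, with the topology of a subspace of $\mathrm{SL}_3(\mathbb{R})^{2g+p} \subset M_3(\mathbb{R})^{2g+p}$ given by evaluation on the generators. Then the quotient $$\mathrm{Rep}_P^{irr} = \mathrm{Hom}_P^{irr} / \mathrm{SL}_3(\mathbb{R})$$ by conjugation, with the quotient topology, is a manifold of dimension $16g - 16 + 6p$ (and is empty when this number is negative). More precisely, $\mathrm{Rep}_P^{irr}$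 is Hausdorff and second countable, and it has a $C^\infty$ manifold structure of dimension $16g-16+6p$, compatible with its topology, for which the projection $\mathrm{Hom}_P^{irr} \to \mathrm{Rep}_P^{irr}$ is locally the restriction of a $C^\infty$ map defined on an open subset of $M_3(\mathbb{R})^{2g+p}$ and has, through every point of $\mathrm{Hom}_P^{irr}$, a local section that is $C^\infty$ as a map into $M_3(\mathbb{R})^{2g+p}$. -/

import Mathlib

open scoped Manifold ContDiff MatrixGroups Topology commutatorElement

noncomputable section

namespace PuncturedSurface

/-- The index set of the `2g + p` standard generators of `π₁(Σ_{g,p})`. -/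
abbrev Gen (g p : ℕ) : Type := Fin g ⊕ Fin g ⊕ Fin p

/-- The first loop `a_i` around the `i`-th handle. -/
def Gen.a {g p : ℕ} (i : Fin g) : Gen g p := Sum.inl i

/-- The second loop `b_i` around the `i`-th handle. -/
def Gen.b {g p : ℕ} (i : Fin g) : Gen g p := Sum.inr (Sum.inl i)

/-- The loop `c_j` around the `j`-th puncture. -/
def Gen.c {g p : ℕ} (j : Fin p) : Gen g p := Sum.inr (Sum.inr j)

/-- The word `[a₁, b₁] ⋯ [a_g, b_g] c₁ ⋯ c_p`. -/
def relator (g p : ℕ) : FreeGroup (Gen g p) :=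
  (List.ofFn fun i : Fin g => ⁅FreeGroup.of (Gen.a i : Gen g p), FreeGroup.of (Gen.b i)⁆).prod *
    (List.ofFn fun j : Fin p => FreeGroup.of (Gen.c j : Gen g p)).prod

/-- The fundamental group of the surface of genus `g` with `p` punctures:
`⟨a₁,…,a_g, b₁,…,b_g, c₁,…,c_p | [a₁, b₁] ⋯ [a_g, b_g] c₁ ⋯ c_p = 1⟩`. -/
abbrev Pi1 (g p : ℕ) : Type := PresentedGroup {relator g p}

/-- The class of a standard generator in `π₁(Σ_{g,p})`. -/
def gen {g p : ℕ} (s : Gen g p) : Pi1 g p := PresentedGroup.of s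

/-- The unipotent Jordan block of size three. -/
def jordanBlock : SL(3, ℝ) :=
  ⟨!![1, 1, 0; 0, 1, 1; 0, 0, 1], by simp [Matrix.det_fin_three]⟩

/-- An element of `SL₃(ℝ)` is parabolic if it is conjugate to the unipotent Jordan block. -/
def IsParabolic (A : SL(3, ℝ)) : Prop := IsConj jordanBlock A

/-- The linear representation on `ℝ³` attached to a morphism into `SL₃(ℝ)`. -/
def linearRep {G : Type*} [Group G] (ρ : G →* SL(3, ℝ)) : Representation ℝ G (Fin 3 → ℝ) :=
  (LinearEquiv.automorphismGroup.toLinearMapMonoidHom.comp Matrix.SpecialLinearGroup.toLin').comp ρ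

/-- `Hom_P^irr`: the irreducible representations of `π₁(Σ_{g,p})` in `SL₃(ℝ)` that send every
puncture loop to a parabolic element. -/
def HomPIrr (g p : ℕ) : Type :=
  {ρ : Pi1 g p →* SL(3, ℝ) //
    (linearRep ρ).IsIrreducible ∧ ∀ j : Fin p, IsParabolic (ρ (gen (Gen.c j)))}

/-- `Hom_P^irr` is topologized as a subspace of `SL₃(ℝ)^{2g+p}`, by evaluation on the standard
generators. -/
instance (g p : ℕ) : TopologicalSpace (HomPIrr g p) :=
  TopologicalSpace.induced (fun ρ (s : Gen g p) => ρ.1 (gen s)) inferInstance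

/-- The space of `(2g+p)`-tuples of `3 × 3` real matrices. -/
abbrev MatTuples (g p : ℕ) : Type := Gen g p → Fin 3 → Fin 3 → ℝ

/-- The matrix entries of the images of the standard generators. -/
def entries {g p : ℕ} (ρ : HomPIrr g p) : MatTuples g p :=
  fun s i j => (ρ.1 (gen s) : Matrix (Fin 3) (Fin 3) ℝ) i j

/-- Conjugation by elements of `SL₃(ℝ)`, that is, the orbit relation of its action on
`Hom_P^irr`. -/
instance conjSetoid (g p : ℕ) : Setoid (HomPIrr g p) where
  r ρ ρ' := ∃ h : SL(3, ℝ), ∀ γ : Pi1 g p, ρ'.1 γ = h * ρ.1 γ * h⁻¹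
  iseqv :=
    { refl := fun _ => ⟨1, fun _ => by simp⟩
      symm := fun ⟨h, hh⟩ => ⟨h⁻¹, fun γ => by rw [hh γ]; group⟩
      trans := fun ⟨h, hh⟩ ⟨k, hk⟩ => ⟨k * h, fun γ => by rw [hk γ, hh γ]; group⟩ }

/-- `Rep_P^irr = Hom_P^irr / SL₃(ℝ)`. -/
def RepPIrr (g p : ℕ) : Type := Quotient (conjSetoid g p)

/-- `Rep_P^irr` carries the quotient topology. -/
instance (g p : ℕ) : TopologicalSpace (RepPIrr g p) :=
  inferInstanceAs (TopologicalSpace (Quotient (conjSetoid g p)))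

/-- The projection `Hom_P^irr → Rep_P^irr`. -/
def proj {g p : ℕ} (ρ : HomPIrr g p) : RepPIrr g p := Quotient.mk (conjSetoid g p) ρ

/-- Near `ρ`, the projection `Hom_P^irr → Rep_P^irr` is the restriction of a smooth map defined on
a neighbourhood in the space of matrix tuples. -/
def ProjSmoothAt {g p d : ℕ} [ChartedSpace (EuclideanSpace ℝ (Fin d)) (RepPIrr g p)]
    (ρ : HomPIrr g p) : Prop :=
  ∃ F : MatTuples g p → RepPIrr g p,
    ContMDiffAt 𝓘(ℝ, MatTuples g p) (𝓡 d) ∞ F (entries ρ) ∧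
      ∀ᶠ ρ' in 𝓝 ρ, F (entries ρ') = proj ρ'

/-- The projection `Hom_P^irr → Rep_P^irr` has a smooth local section through `ρ`. -/
def HasSmoothLocalSectionAt {g p d : ℕ} [ChartedSpace (EuclideanSpace ℝ (Fin d)) (RepPIrr g p)]
    (ρ : HomPIrr g p) : Prop :=
  ∃ σ : RepPIrr g p → HomPIrr g p,
    σ (proj ρ) = ρ ∧ (∀ᶠ x in 𝓝 (proj ρ), proj (σ x) = x) ∧
      ContMDiffAt (𝓡 d) 𝓘(ℝ, MatTuples g p) ∞ (fun x => entries (σ x)) (proj ρ)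

end PuncturedSurface

end

noncomputable section

namespace PuncturedSurface

/-! ### Rescaling invertible matrices into `SL(3, ℝ)` -/

open Matrix

/-- The algebra of real `3 × 3` matrices. -/
local notation "M₃" => Matrix (Fin 3) (Fin 3) ℝ

/-! The quotient is charted by slices cut out by smooth equations in the space of all matrix tuples.
A tuple defines a representation with parabolic punctures when all determinants are 1, every `c_j`
has trace 3 and adjugate of trace 3 with `(c_j - 1)² ≠ 0`, and the relator is 1. A scalar matrix of
determinant one is 1 over `ℝ`, so the relator needs only 8 equations, modulo scalars.

Conjugation is removed by a frame. The fixed space of a parabolic element is a line, and by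
irreducibility three words move a fixed vector of one puncture to a basis. This frame is equivariant
up to scale (`exists_frame_conj`), so asking it to be scalar costs 8 more equations and picks one
point in each orbit near the given one; conjugating by the inverse frame (`normalForm`) retracts
onto these points.

All equations together are submersive at every representation (`surjective_fderiv_sliceEq`). The
local ones are so because the Jordan block is regular. For the relator, a traceless matrix
orthogonal, under the trace form, to its derivative commutes with the whole image, hence is scalar
by Schur's lemma, hence zero. The frame sees exactly the orbit directions. There remain `9(2g+p) -
(2g+3p+16) = 16g+6p-16` dimensions, and a negative difference rules out any representation. The
implicit function theorem gives the charts; transitions are smooth because conjugation extends to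
the ambient space.

The quotient is Hausdorff because a nonzero intertwiner between irreducible representations is
invertible and can be normalized to lie on a compact sphere. -/

theorem exists_pow_three_eq (d : ℝ) : ∃ c : ℝ, c ^ 3 = d := by
  have hcont : Continuous fun x : ℝ => x ^ 3 := by fun_prop
  refine hcont.surjective (Filter.tendsto_pow_atTop (by norm_num)) ?_ d
  have h := Filter.tendsto_neg_atTop_atBot.comp
    ((Filter.tendsto_pow_atTop (α := ℝ) (n := 3) (by norm_num)).comp Filter.tendsto_neg_atBot_atTop)
  refine h.congr fun x => ?_
  simp only [Function.comp_apply]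
  ring

/-- A matrix with nonzero determinant is proportional to an element of `SL₃(ℝ)`. -/
theorem exists_smul_coe_eq {K : M₃} (hK : K.det ≠ 0) :
    ∃ (c : ℝ) (h : SL(3, ℝ)), c ≠ 0 ∧ K = c • (h : M₃) := by
  -- In odd dimension every real determinant has a real root of the right order, so a scalar factor
  -- brings the determinant to 1; conjugation does not see this factor.
  obtain ⟨c, hc⟩ := exists_pow_three_eq K.det
  have hc0 : c ≠ 0 := by rintro rfl; exact hK (by simpa using hc.symm)
  refine ⟨c, ⟨c⁻¹ • K, ?_⟩, hc0, ?_⟩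
  · rw [det_smul, ← hc]; simp [hc0]
  · simp [smul_smul, hc0]

/-- Elements of `SL₃(ℝ)` that are conjugate under an invertible matrix are conjugate. -/
theorem exists_conj_of_intertwines {T : M₃} (hT : T.det ≠ 0) :
    ∃ h : SL(3, ℝ), ∀ A B : SL(3, ℝ), T * (A : M₃) = B * T → B = h * A * h⁻¹ := by
  obtain ⟨c, h, hc, rfl⟩ := exists_smul_coe_eq hT
  refine ⟨h, fun A B hAB => eq_mul_inv_of_mul_eq ?_⟩
  rw [smul_mul_assoc, mul_smul_comm] at hAB
  exact Subtype.ext (smul_right_injective _ hc hAB).symm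

/-! ### Parabolic elements: equations, normal form, fixed line -/

section Parabolic

theorem IsParabolic.exists_eq {c : SL(3, ℝ)} (hc : IsParabolic c) :
    ∃ h : SL(3, ℝ), c = h * jordanBlock * h⁻¹ := by
  obtain ⟨h, hh⟩ := isConj_iff.1 hc
  exact ⟨h, hh.symm⟩

theorem coe_conj (h A : SL(3, ℝ)) : ((h * A * h⁻¹ : SL(3, ℝ)) : M₃) = h * A * adjugate (h : M₃) := by
  rw [Matrix.SpecialLinearGroup.coe_mul, Matrix.SpecialLinearGroup.coe_mul,
    Matrix.SpecialLinearGroup.coe_inv]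

theorem coe_mul_adjugate (h : SL(3, ℝ)) : (h : M₃) * adjugate (h : M₃) = 1 := by
  simp [mul_adjugate]

theorem adjugate_mul_coe (h : SL(3, ℝ)) : adjugate (h : M₃) * (h : M₃) = 1 := by
  simp [adjugate_mul]

theorem adjugate_conj (h : SL(3, ℝ)) (M : M₃) :
    adjugate ((h : M₃) * M * adjugate (h : M₃)) = h * adjugate M * adjugate (h : M₃) := by
  have h1 : adjugate (adjugate (h : M₃)) = h := by
    rw [← Matrix.SpecialLinearGroup.coe_inv, ← Matrix.SpecialLinearGroup.coe_inv, inv_inv]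
  rw [adjugate_mul_distrib, adjugate_mul_distrib, h1, mul_assoc]

theorem trace_conj (h : SL(3, ℝ)) (M : M₃) :
    ((h : M₃) * M * adjugate (h : M₃)).trace = M.trace := by
  rw [trace_mul_comm, ← mul_assoc, adjugate_mul_coe, one_mul]

theorem det_conj (h : SL(3, ℝ)) (M : M₃) :
    ((h : M₃) * M * adjugate (h : M₃)).det = M.det := by
  rw [det_mul, det_mul, mul_right_comm, ← det_mul, coe_mul_adjugate, det_one, one_mul]

theorem coe_jordanBlock : (jordanBlock : M₃) = !![1, 1, 0; 0, 1, 1; 0, 0, 1] := rfl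

theorem coe_conj_sub_one (h : SL(3, ℝ)) :
    ((h * jordanBlock * h⁻¹ : SL(3, ℝ)) : M₃) - 1 =
      (h : M₃) * !![0, 1, 0; 0, 0, 1; 0, 0, 0] * adjugate (h : M₃) := by
  have : !![0, 1, 0; 0, 0, 1; 0, 0, 0] = (jordanBlock : M₃) - 1 := by
    rw [coe_jordanBlock]
    ext i j
    fin_cases i <;> fin_cases j <;> simp
  rw [coe_conj, this, mul_sub, sub_mul, mul_one, coe_mul_adjugate]

theorem IsParabolic.trace_eq {c : SL(3, ℝ)} (hc : IsParabolic c) : (c : M₃).trace = 3 := by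
  obtain ⟨h, rfl⟩ := hc.exists_eq
  rw [coe_conj, trace_conj, coe_jordanBlock]
  simp [trace, Fin.sum_univ_three]; norm_num

theorem IsParabolic.trace_adjugate_eq {c : SL(3, ℝ)} (hc : IsParabolic c) :
    (adjugate (c : M₃)).trace = 3 := by
  obtain ⟨h, rfl⟩ := hc.exists_eq
  rw [coe_conj, adjugate_conj, trace_conj, coe_jordanBlock, adjugate_fin_three]
  simp [trace, Fin.sum_univ_three]; norm_num

/-- This open condition separates the regular unipotent class from the smaller ones, which satisfy
the same trace and determinant equations. -/
theorem IsParabolic.sub_one_pow_two_ne_zero {c : SL(3, ℝ)} (hc : IsParabolic c) :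
    ((c : M₃) - 1) ^ 2 ≠ 0 := by
  obtain ⟨h, rfl⟩ := hc.exists_eq
  rw [coe_conj_sub_one]
  intro h0
  have h1 : adjugate (h : M₃) * ((h : M₃) * !![0, 1, 0; 0, 0, 1; 0, 0, 0] * adjugate (h : M₃)) ^ 2 *
      (h : M₃) = !![0, 1, 0; 0, 0, 1; 0, 0, 0] ^ 2 := by
    rw [pow_two, pow_two]
    simp only [mul_assoc, adjugate_mul_coe, mul_one]
    simp only [← mul_assoc, adjugate_mul_coe, one_mul]
  rw [h0] at h1
  have h2 := congrFun (congrFun h1 0) 2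
  simp [pow_two, mul_apply, Fin.sum_univ_three] at h2

/-- The Cayley-Hamilton theorem for `3 × 3` matrices. -/
theorem cayleyHamilton_three (c : M₃) :
    c ^ 3 - c.trace • c ^ 2 + (adjugate c).trace • c - c.det • (1 : M₃) = 0 := by
  rw [adjugate_fin_three, det_fin_three]
  ext i j
  fin_cases i <;> fin_cases j <;>
    simp [pow_succ, mul_apply, Fin.sum_univ_three, trace] <;> ring

/-- The three hypotheses say that the characteristic polynomial is `(X - 1)³`. Unipotence is thus
given by smooth, independent equations. -/
theorem sub_one_pow_three_eq_zero {c : M₃} (h1 : c.det = 1) (h2 : c.trace = 3)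
    (h3 : (adjugate c).trace = 3) : (c - 1) ^ 3 = 0 := by
  have h := cayleyHamilton_three c
  rw [h1, h2, h3] at h
  rw [← h]
  simp only [pow_succ, pow_zero, one_mul, sub_mul, mul_sub, mul_one, ofNat_smul_eq_nsmul, one_smul]
  abel

theorem IsParabolic.sub_one_pow_three {c : SL(3, ℝ)} (hc : IsParabolic c) :
    ((c : M₃) - 1) ^ 3 = 0 :=
  sub_one_pow_three_eq_zero c.2 hc.trace_eq hc.trace_adjugate_eq

theorem exists_mulVec_ne_zero {A : M₃} (hA : A ≠ 0) : ∃ e : Fin 3 → ℝ, A *ᵥ e ≠ 0 := by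
  by_contra! h
  exact hA (by ext i j; simpa using congrFun (h (Pi.single j 1)) i)

/-- With `n = c - 1` and `n² e ≠ 0`, the vectors `n² e`, `n e`, `e` form a basis in which `c` is the
Jordan block. The change of basis need not have determinant one; rescaling repairs this. -/
theorem isParabolic_of_sub_one_pow {c : SL(3, ℝ)} (h3 : ((c : M₃) - 1) ^ 3 = 0)
    (h2 : ((c : M₃) - 1) ^ 2 ≠ 0) : IsParabolic c := by
  obtain ⟨e, he⟩ := exists_mulVec_ne_zero h2
  set n : M₃ := (c : M₃) - 1 with hn
  have hc : (c : M₃) = 1 + n := by simp [hn]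
  have hn3 : n *ᵥ (n *ᵥ (n *ᵥ e)) = 0 := by
    rw [mulVec_mulVec, mulVec_mulVec, ← pow_two, ← pow_succ, h3, zero_mulVec]
  have hn2 : n *ᵥ (n *ᵥ e) ≠ 0 := by rwa [mulVec_mulVec, ← pow_two]
  let f : Fin 3 → Fin 3 → ℝ := ![n *ᵥ (n *ᵥ e), n *ᵥ e, e]
  have hlin : LinearIndependent ℝ f := by
    rw [Fintype.linearIndependent_iff]
    intro g hg
    simp only [f, Fin.sum_univ_three, cons_val_zero, cons_val_one, cons_val_two] at hg
    have e2 := congrArg (fun v => n *ᵥ (n *ᵥ v)) hg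
    simp only [mulVec_add, mulVec_smul, hn3, mulVec_zero, smul_zero, zero_add] at e2
    have g2 : g 2 = 0 := (smul_eq_zero.1 e2).resolve_right hn2
    rw [g2, zero_smul, add_zero] at hg
    have e1 := congrArg (fun v => n *ᵥ v) hg
    simp only [mulVec_add, mulVec_smul, hn3, mulVec_zero, smul_zero, zero_add] at e1
    have g1 : g 1 = 0 := (smul_eq_zero.1 e1).resolve_right hn2
    rw [g1, zero_smul, add_zero] at hg
    have g0 : g 0 = 0 := (smul_eq_zero.1 hg).resolve_right hn2
    intro i; fin_cases i <;> assumption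
  have hdet : ((Matrix.of f)ᵀ).det ≠ 0 := by
    rw [det_transpose]
    exact ((Matrix.isUnit_iff_isUnit_det _).1
      (Matrix.linearIndependent_rows_iff_isUnit.1 hlin)).ne_zero
  obtain ⟨h, hh⟩ := exists_conj_of_intertwines hdet
  refine isConj_iff.2 ⟨h, (hh jordanBlock c ?_).symm⟩
  rw [hc, coe_jordanBlock]
  have e0 : ∀ i, ((n * (n * n)) *ᵥ e) i = 0 := fun i => by
    rw [← mulVec_mulVec, ← mulVec_mulVec, hn3, Pi.zero_apply]
  ext i j
  have hcol : (n * (Matrix.of f)ᵀ) i j = (n *ᵥ f j) i := rfl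
  rw [add_mul, Matrix.add_apply, hcol, one_mul]
  fin_cases j <;>
    simp [mul_apply, Fin.sum_univ_three, f, e0] <;> ring

/-- The fixed space of a parabolic element is a line. -/
theorem IsParabolic.exists_eq_smul {c : SL(3, ℝ)} (hc : IsParabolic c) {u w : Fin 3 → ℝ}
    (hu : ((c : M₃) - 1) *ᵥ u = 0) (hw : ((c : M₃) - 1) *ᵥ w = 0) (hw0 : w ≠ 0) :
    ∃ μ : ℝ, u = μ • w := by
  obtain ⟨h, rfl⟩ := hc.exists_eq
  -- After conjugation by `h`, the kernel of `c - 1` is that of the standard nilpotent block, the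
  -- line of the first basis vector.
  have key : ∀ y : Fin 3 → ℝ, (((h * jordanBlock * h⁻¹ : SL(3, ℝ)) : M₃) - 1) *ᵥ y = 0 →
      y = (adjugate (h : M₃) *ᵥ y) 0 • ((h : M₃) *ᵥ Pi.single 0 1) := by
    intro y hy
    rw [coe_conj_sub_one, mul_assoc, ← mulVec_mulVec] at hy
    have h1 := congrArg (fun v => adjugate (h : M₃) *ᵥ v) hy
    simp only [mulVec_mulVec, mulVec_zero] at h1
    rw [← mul_assoc, adjugate_mul_coe, one_mul, ← mulVec_mulVec] at h1
    have hz : ∀ z : Fin 3 → ℝ, (!![0, 1, 0; 0, 0, 1; 0, 0, 0] : M₃) *ᵥ z = 0 →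
        z = z 0 • Pi.single 0 1 := by
      intro z hz
      have hz0 := congrFun hz 0
      have hz1 := congrFun hz 1
      simp [mulVec, dotProduct, Fin.sum_univ_three] at hz0 hz1
      ext i; fin_cases i <;> simp [hz0, hz1]
    have h2 := congrArg (fun v => (h : M₃) *ᵥ v) (hz _ h1)
    simp only [mulVec_smul] at h2
    rwa [mulVec_mulVec, coe_mul_adjugate, one_mulVec] at h2
  have ku := key u hu
  have kw := key w hw
  have h0 : (adjugate (h : M₃) *ᵥ w) 0 ≠ 0 := by
    intro h0; rw [h0, zero_smul] at kw; exact hw0 kw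
  refine ⟨(adjugate (h : M₃) *ᵥ u) 0 / (adjugate (h : M₃) *ᵥ w) 0, ?_⟩
  rw [ku, kw]
  simp only [smul_smul]
  congr 1
  rw [← kw]
  field_simp
  rw [← ku]

end Parabolic

/-! ### Matrices modulo scalars, the trace pairing, and transvections -/

section SquareZero

/-- The coordinates of a matrix modulo the scalar matrices. -/
def modScalar : M₃ →ₗ[ℝ] (Fin 8 → ℝ) where
  toFun M := ![M 0 1, M 0 2, M 1 0, M 1 2, M 2 0, M 2 1, M 0 0 - M 1 1, M 1 1 - M 2 2]
  map_add' M N := by ext i; fin_cases i <;> simp <;> ring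
  map_smul' c M := by ext i; fin_cases i <;> simp <;> ring

theorem modScalar_surjective : Function.Surjective modScalar := by
  intro y
  refine ⟨!![y 6, y 0, y 1; y 2, 0, y 3; y 4, y 5, - y 7], ?_⟩
  ext i; fin_cases i <;> simp [modScalar]

theorem modScalar_smul_one (c : ℝ) : modScalar (c • (1 : M₃)) = 0 := by
  ext i; fin_cases i <;> simp [modScalar]

theorem modScalar_one : modScalar (1 : M₃) = 0 := by
  simpa using modScalar_smul_one 1

theorem eq_smul_one_of_modScalar {M : M₃} (hM : modScalar M = 0) : M = M 0 0 • (1 : M₃) := by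
  have h := fun i => congrFun hM i
  have h0 := h 0; have h1 := h 1; have h2 := h 2; have h3 := h 3
  have h4 := h 4; have h5 := h 5; have h6 := h 6; have h7 := h 7
  simp [modScalar, sub_eq_zero] at h0 h1 h2 h3 h4 h5 h6 h7
  ext i j; fin_cases i <;> fin_cases j <;> simp [*]

/-- The scalar `m` satisfies `m³ = 1`, whose only real solution is 1. Hence the relator equation
loses nothing modulo scalars. -/
theorem eq_one_of_modScalar {M : M₃} (hM : modScalar M = 0) (hdet : M.det = 1) : M = 1 := by
  have h := eq_smul_one_of_modScalar hM
  rw [h, det_smul, det_one, mul_one, Fintype.card_fin] at hdet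
  have : M 0 0 = 1 := by
    nlinarith [sq_nonneg (M 0 0 + 1), sq_nonneg (M 0 0)]
  rw [h, this, one_smul]

/-- A traceless matrix that is orthogonal to the matrices of square zero vanishes. -/
theorem eq_zero_of_trace_mul {A : M₃} (htr : A.trace = 0)
    (h : ∀ N : M₃, N * N = 0 → (A * N).trace = 0) : A = 0 := by
  have h01 := h !![0, 1, 0; 0, 0, 0; 0, 0, 0] (by ext i j; fin_cases i <;> fin_cases j <;> simp [mul_apply, Fin.sum_univ_three])
  have h02 := h !![0, 0, 1; 0, 0, 0; 0, 0, 0] (by ext i j; fin_cases i <;> fin_cases j <;> simp [mul_apply, Fin.sum_univ_three])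
  have h10 := h !![0, 0, 0; 1, 0, 0; 0, 0, 0] (by ext i j; fin_cases i <;> fin_cases j <;> simp [mul_apply, Fin.sum_univ_three])
  have h12 := h !![0, 0, 0; 0, 0, 1; 0, 0, 0] (by ext i j; fin_cases i <;> fin_cases j <;> simp [mul_apply, Fin.sum_univ_three])
  have h20 := h !![0, 0, 0; 0, 0, 0; 1, 0, 0] (by ext i j; fin_cases i <;> fin_cases j <;> simp [mul_apply, Fin.sum_univ_three])
  have h21 := h !![0, 0, 0; 0, 0, 0; 0, 1, 0] (by ext i j; fin_cases i <;> fin_cases j <;> simp [mul_apply, Fin.sum_univ_three])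
  -- The matrix units kill the off-diagonal entries of `A`. These two rank-one matrices of square
  -- zero then compare neighbouring diagonal entries, and the trace condition finishes.
  have h3 := h !![1, -1, 0; 1, -1, 0; 0, 0, 0] (by ext i j; fin_cases i <;> fin_cases j <;> simp [mul_apply, Fin.sum_univ_three])
  have h4 := h !![0, 0, 0; 0, 1, -1; 0, 1, -1] (by ext i j; fin_cases i <;> fin_cases j <;> simp [mul_apply, Fin.sum_univ_three])
  simp [trace, mul_apply, Fin.sum_univ_three] at htr h01 h02 h10 h12 h20 h21 h3 h4
  simp [h01, h10, h12, h21] at h3 h4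
  have d0 : A 0 0 = 0 := by linarith
  have d1 : A 1 1 = 0 := by linarith
  have d2 : A 2 2 = 0 := by linarith
  ext i j; fin_cases i <;> fin_cases j <;> simp [*]

/-- Linear forms on matrices are given by the trace pairing. -/
theorem exists_trace_mul_eq (f : M₃ →ₗ[ℝ] ℝ) : ∃ A : M₃, ∀ M, f M = (A * M).trace := by
  refine ⟨Matrix.of fun i j => f (Matrix.single j i 1), fun M => ?_⟩
  conv_lhs => rw [matrix_eq_sum_single M]
  simp only [map_sum, trace, diag, mul_apply, of_apply]
  rw [Finset.sum_comm]
  refine Finset.sum_congr rfl fun i _ => Finset.sum_congr rfl fun j _ => ?_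
  have : Matrix.single j i (M j i) = M j i • Matrix.single j i (1 : ℝ) := by simp [smul_single]
  rw [this, map_smul, smul_eq_mul, mul_comm]

theorem trace_eq_zero_of_mul_self {N : M₃} (hN : N * N = 0) : N.trace = 0 :=
  (isNilpotent_trace_of_isNilpotent ⟨2, by rw [pow_two, hN]⟩).eq_zero

/-- The characteristic polynomial of the nilpotent `-N` is `X³`; its value at 1 is the determinant.
-/
theorem det_one_add_of_mul_self {N : M₃} (hN : N * N = 0) : (1 + N).det = 1 := by
  have h : IsNilpotent (-N) := ⟨2, by rw [pow_two, neg_mul_neg, hN]⟩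
  have h1 := (isNilpotent_charpoly_sub_pow_of_isNilpotent h).eq_zero
  have h2 := eval_charpoly (-N) 1
  rw [sub_eq_zero.1 h1] at h2
  simpa using h2.symm

/-- The transvection `1 + t N` attached to a matrix of square zero. -/
def transvec (N : M₃) (hN : N * N = 0) (t : ℝ) : SL(3, ℝ) :=
  ⟨1 + t • N, det_one_add_of_mul_self (by rw [smul_mul_smul_comm, hN, smul_zero])⟩

theorem coe_transvec (N : M₃) (hN : N * N = 0) (t : ℝ) :
    (transvec N hN t : M₃) = 1 + t • N := rfl

theorem transvec_zero (N : M₃) (hN : N * N = 0) : transvec N hN 0 = 1 :=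
  Subtype.ext (by rw [coe_transvec, zero_smul, add_zero]; rfl)

theorem transvec_inv (N : M₃) (hN : N * N = 0) (t : ℝ) :
    (transvec N hN t)⁻¹ = transvec N hN (-t) := by
  refine inv_eq_of_mul_eq_one_right (Subtype.ext ?_)
  change (1 + t • N) * (1 + (-t) • N) = 1
  rw [mul_add, mul_one, add_mul, smul_mul_smul_comm, hN, smul_zero, one_mul, add_zero, neg_smul]
  abel

theorem coe_transvec_inv (N : M₃) (hN : N * N = 0) (t : ℝ) :
    ((transvec N hN t)⁻¹ : SL(3, ℝ)) = (1 - t • N : M₃) := by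
  rw [transvec_inv, coe_transvec, neg_smul, sub_eq_add_neg]

end SquareZero

/-! ### Manifold structure on a quotient with local slices -/

section Slice

open Set

variable {E X Q W : Type*} [NormedAddCommGroup E] [NormedSpace ℝ E]
  [NormedAddCommGroup W] [NormedSpace ℝ W]

/-- A local slice through `x` for the projection `π : X → Q`, where `X` is mapped to a normed
space by `ι`: an invariant smooth function `F` on a neighbourhood of `x`, together with a smooth
map `s` into `X` that inverts it up to the fibres of `π`. -/
structure LocalSlice (ι : X → E) (π : X → Q) (W : Type*) [NormedAddCommGroup W]
    [NormedSpace ℝ W] (x : X) where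
  /-- The ambient domain of the invariant function. -/
  U : Set E
  /-- The domain of the section. -/
  V : Set W
  /-- The invariant function. -/
  F : E → W
  /-- The section. -/
  s : W → X
  isOpen_U : IsOpen U
  isOpen_V : IsOpen V
  mem_U : ι x ∈ U
  contDiffOn_F : ContDiffOn ℝ ∞ F U
  contDiffOn_s : ContDiffOn ℝ ∞ (ι ∘ s) V
  F_mem : ∀ y, ι y ∈ U → F (ι y) ∈ V
  π_s : ∀ y, ι y ∈ U → π (s (F (ι y))) = π y
  s_mem : ∀ v ∈ V, ι (s v) ∈ U
  F_s : ∀ v ∈ V, F (ι (s v)) = v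
  F_inv : ∀ y z, ι y ∈ U → ι z ∈ U → π y = π z → F (ι y) = F (ι z)
  -- Required at the base point only: the local section must pass through `x` itself and not merely
  -- through its fibre.
  s_base : s (F (ι x)) = x

namespace LocalSlice

variable {ι : X → E} {π : X → Q} {x : X}

open Classical in
/-- The function on `Q` induced by the invariant function of a local slice. -/
def toFun (S : LocalSlice ι π W x) (q : Q) : W :=
  -- By `F_inv` the choice of representative is immaterial; the value 0 occurs only off the source
  -- of the chart.
  if h : ∃ y, ι y ∈ S.U ∧ π y = q then S.F (ι h.choose) else 0

theorem toFun_π (S : LocalSlice ι π W x) {y : X} (hy : ι y ∈ S.U) :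
    S.toFun (π y) = S.F (ι y) := by
  have h : ∃ z, ι z ∈ S.U ∧ π z = π y := ⟨y, hy, rfl⟩
  rw [toFun, dif_pos h]
  exact S.F_inv _ _ h.choose_spec.1 hy h.choose_spec.2

variable [TopologicalSpace X]

theorem continuousOn_s (hι : Topology.IsInducing ι) (S : LocalSlice ι π W x) :
    ContinuousOn S.s S.V :=
  hι.continuousOn_iff.2 S.contDiffOn_s.continuousOn

variable [TopologicalSpace Q]

/-- The chart of `Q` given by a local slice. -/
def chart (hι : Topology.IsInducing ι) (hπ : IsOpenQuotientMap π) (S : LocalSlice ι π W x) :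
    OpenPartialHomeomorph Q W where
  toFun := S.toFun
  invFun v := π (S.s v)
  source := π '' (ι ⁻¹' S.U)
  target := S.V
  map_source' := by
    rintro _ ⟨y, hy, rfl⟩
    rw [S.toFun_π hy]
    exact S.F_mem y hy
  map_target' v hv := ⟨S.s v, S.s_mem v hv, rfl⟩
  left_inv' := by
    rintro _ ⟨y, hy, rfl⟩
    rw [S.toFun_π hy]
    exact S.π_s y hy
  right_inv' v hv := by rw [S.toFun_π (S.s_mem v hv), S.F_s v hv]
  open_source := hπ.isOpenMap _ (S.isOpen_U.preimage hι.continuous)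
  open_target := S.isOpen_V
  continuousOn_toFun := by
    rintro _ ⟨y, hy, rfl⟩
    have hU : ι ⁻¹' S.U ∈ 𝓝 y := (S.isOpen_U.preimage hι.continuous).mem_nhds hy
    -- Continuity can be tested upstairs, where the function agrees with `S.F ∘ ι` near `y`.
    refine ContinuousAt.continuousWithinAt (hπ.continuousAt_comp_iff.1 ?_)
    have h : ContinuousAt (S.F ∘ ι) y :=
      (S.contDiffOn_F.continuousOn.continuousAt (S.isOpen_U.mem_nhds hy)).comp
        hι.continuous.continuousAt
    refine h.congr ?_
    filter_upwards [hU] with z hz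
    exact (S.toFun_π hz).symm
  continuousOn_invFun := hπ.continuous.comp_continuousOn (S.continuousOn_s hι)

/-- The transition maps between the charts given by local slices are smooth, provided that the
fibres of `π` are the orbits of symmetries that extend to smooth maps of the ambient space. -/
theorem contDiffOn_transition
    (hsymm : ∀ y z, π y = π z → ∃ (a : X → X) (A : E → E), ContDiff ℝ ∞ A ∧
      (∀ w, ι (a w) = A (ι w)) ∧ (∀ w, π (a w) = π w) ∧ a y = z)
    {x' : X} (S : LocalSlice ι π W x) (S' : LocalSlice ι π W x') :
    ContDiffOn ℝ ∞ (S'.toFun ∘ π ∘ S.s) (S.V ∩ (π ∘ S.s) ⁻¹' (π '' (ι ⁻¹' S'.U))) := by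
  rintro v ⟨hv, ⟨z, hz, hzv⟩⟩
  -- The point `S.s v` need not lie in the domain of `S'`, only its fibre meets it. A symmetry moves
  -- `S.s v` to `z`, and by continuity keeps nearby points of the section in `S'.U`.
  obtain ⟨a, A, hA, haA, hπa, haz⟩ := hsymm _ _ hzv.symm
  have hs : ContDiffAt ℝ ∞ (ι ∘ S.s) v := S.contDiffOn_s.contDiffAt (S.isOpen_V.mem_nhds hv)
  have hAs : ContDiffAt ℝ ∞ (fun w => A (ι (S.s w))) v := hA.contDiffAt.comp v hs
  have hmem : A (ι (S.s v)) ∈ S'.U := by rw [← haA, haz]; exact hz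
  have hF : ContDiffAt ℝ ∞ S'.F (A (ι (S.s v))) :=
    S'.contDiffOn_F.contDiffAt (S'.isOpen_U.mem_nhds hmem)
  have hcomp : ContDiffAt ℝ ∞ (fun w => S'.F (A (ι (S.s w)))) v := hF.comp v hAs
  refine (hcomp.congr_of_eventuallyEq ?_).contDiffWithinAt
  filter_upwards [hAs.continuousAt.preimage_mem_nhds (S'.isOpen_U.mem_nhds hmem)] with w hw
  have hw' : ι (a (S.s w)) ∈ S'.U := by rw [haA]; exact hw
  change S'.toFun (π (S.s w)) = _
  rw [← hπa (S.s w), S'.toFun_π hw', haA]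

/-- Local slices through all points make the quotient a smooth manifold, for which the projection
is locally the restriction of a smooth map and has smooth local sections. -/
theorem exists_isManifold (hι : Topology.IsInducing ι) (hπ : IsOpenQuotientMap π)
    (hsymm : ∀ y z, π y = π z → ∃ (a : X → X) (A : E → E), ContDiff ℝ ∞ A ∧
      (∀ w, ι (a w) = A (ι w)) ∧ (∀ w, π (a w) = π w) ∧ a y = z)
    (S : ∀ x, LocalSlice ι π W x) :
    ∃ _ : ChartedSpace W Q, IsManifold 𝓘(ℝ, W) ∞ Q ∧ ∀ x : X,
      (∃ F : E → Q, ContMDiffAt 𝓘(ℝ, E) 𝓘(ℝ, W) ∞ F (ι x) ∧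
        ∀ᶠ y in 𝓝 x, F (ι y) = π y) ∧
      ∃ σ : Q → X, σ (π x) = x ∧ (∀ᶠ q in 𝓝 (π x), π (σ q) = q) ∧
        ContMDiffAt 𝓘(ℝ, W) 𝓘(ℝ, E) ∞ (fun q => ι (σ q)) (π x) := by
  let c : ∀ x, OpenPartialHomeomorph Q W := fun x => (S x).chart hι hπ
  let _ : ChartedSpace W Q :=
    { atlas := Set.range c
      chartAt := fun q => c (hπ.surjective q).choose
      mem_chart_source := fun q =>
        ⟨_, (S (hπ.surjective q).choose).mem_U, (hπ.surjective q).choose_spec⟩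
      chart_mem_atlas := fun q => ⟨_, rfl⟩ }
  have hM : IsManifold 𝓘(ℝ, W) ∞ Q := by
    refine isManifold_of_contDiffOn _ _ _ ?_
    rintro _ _ ⟨x, rfl⟩ ⟨x', rfl⟩
    simp only [modelWithCornersSelf_coe, modelWithCornersSelf_coe_symm, Function.id_comp,
      Function.comp_id, Set.preimage_id, Set.range_id, Set.inter_univ]
    exact contDiffOn_transition hsymm (S x) (S x')
  refine ⟨inferInstance, hM, fun x => ?_⟩
  have hc : c x ∈ IsManifold.maximalAtlas 𝓘(ℝ, W) ∞ Q :=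
    IsManifold.subset_maximalAtlas ⟨x, rfl⟩
  have hx : π x ∈ (c x).source := ⟨x, (S x).mem_U, rfl⟩
  have hxV : (S x).F (ι x) ∈ (S x).V := (S x).F_mem x (S x).mem_U
  have hcx : c x (π x) = (S x).F (ι x) := (S x).toFun_π (S x).mem_U
  refine ⟨⟨fun e => π ((S x).s ((S x).F e)), ?_, ?_⟩, fun q => (S x).s ((S x).toFun q), ?_, ?_, ?_⟩
  · have h1 : ContMDiffAt 𝓘(ℝ, W) 𝓘(ℝ, W) ∞ (c x).symm ((S x).F (ι x)) :=
      (contMDiffOn_symm_of_mem_maximalAtlas hc).contMDiffAt ((S x).isOpen_V.mem_nhds hxV)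
    have h2 : ContMDiffAt 𝓘(ℝ, E) 𝓘(ℝ, W) ∞ (S x).F (ι x) :=
      ((S x).contDiffOn_F.contDiffAt ((S x).isOpen_U.mem_nhds (S x).mem_U)).contMDiffAt
    exact h1.comp (ι x) h2
  · filter_upwards [((S x).isOpen_U.preimage hι.continuous).mem_nhds (S x).mem_U] with y hy
    exact (S x).π_s y hy
  · change (S x).s ((S x).toFun (π x)) = x
    rw [(S x).toFun_π (S x).mem_U, (S x).s_base]
  · filter_upwards [(c x).open_source.mem_nhds hx] with q hq
    exact (c x).left_inv hq
  · have h1 : ContMDiffAt 𝓘(ℝ, W) 𝓘(ℝ, W) ∞ (c x) (π x) :=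
      contMDiffAt_of_mem_maximalAtlas hc hx
    have h2 : ContMDiffAt 𝓘(ℝ, W) 𝓘(ℝ, E) ∞ (ι ∘ (S x).s) (c x (π x)) := by
      rw [hcx]
      exact ((S x).contDiffOn_s.contDiffAt ((S x).isOpen_V.mem_nhds hxV)).contMDiffAt
    exact h2.comp (π x) h1

end LocalSlice

end Slice

/-! ### The relator under variation of one generator -/

section Relator

variable {G : Type*} [Group G] {g p : ℕ}

theorem ofFn_update {α : Type*} {n : ℕ} (B : Fin n → α) (k : Fin n) (y : α) :
    List.ofFn (Function.update B k y) = (List.ofFn B).set k y := by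
  refine List.ext_getElem (by simp) fun m h1 h2 => ?_
  rw [List.getElem_set]
  simp only [List.getElem_ofFn, Function.update_apply, Fin.ext_iff, eq_comm]

theorem prod_ofFn_update {n : ℕ} (B : Fin n → G) (k : Fin n) (y : G) :
    (List.ofFn (Function.update B k y)).prod =
      ((List.ofFn B).take k).prod * y * ((List.ofFn B).drop (k + 1)).prod := by
  rw [ofFn_update, List.prod_set, if_pos (by simp)]

theorem prod_ofFn_eq {n : ℕ} (B : Fin n → G) (k : Fin n) :
    (List.ofFn B).prod =
      ((List.ofFn B).take k).prod * B k * ((List.ofFn B).drop (k + 1)).prod := by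
  rw [← prod_ofFn_update, Function.update_eq_self]

theorem prod_take_ofFn_mem {n : ℕ} (C : Subgroup G) (B : Fin n → G) (k : ℕ)
    (h : ∀ j : Fin n, (j : ℕ) < k → B j ∈ C) : ((List.ofFn B).take k).prod ∈ C := by
  refine C.list_prod_mem fun y hy => ?_
  obtain ⟨m, hm, rfl⟩ := List.mem_take_iff_getElem.1 hy
  rw [lt_min_iff, List.length_ofFn] at hm
  rw [List.getElem_ofFn]
  exact h _ hm.1

/-- The commutators of the handle generators. -/
def handle (X : Gen g p → G) (i : Fin g) : G := ⁅X (Gen.a i), X (Gen.b i)⁆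

/-- The product of the commutators of the handles before the `i`-th one. -/
def handlePrefix (X : Gen g p → G) (i : Fin g) : G := ((List.ofFn (handle X)).take i).prod

/-- The product of all commutators and of the puncture generators before the `j`-th one. -/
def puncturePrefix (X : Gen g p → G) (j : Fin p) : G :=
  (List.ofFn (handle X)).prod * ((List.ofFn fun k => X (Gen.c k)).take j).prod

theorem lift_relator (X : Gen g p → G) :
    FreeGroup.lift X (relator g p) =
      (List.ofFn (handle X)).prod * (List.ofFn fun j => X (Gen.c j)).prod := by
  simp only [relator, map_mul, map_list_prod, List.map_ofFn]
  congr 3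
  · ext i; simp [handle, map_commutatorElement]
  · ext i; simp

theorem handle_update_a (X : Gen g p → G) (i : Fin g) (y : G) :
    handle (Function.update X (Gen.a i) y) = Function.update (handle X) i ⁅y, X (Gen.b i)⁆ := by
  ext k
  rcases eq_or_ne k i with rfl | hk
  · simp [handle, Gen.a, Gen.b]
  · simp [handle, Gen.a, Gen.b, hk]

theorem handle_update_b (X : Gen g p → G) (i : Fin g) (y : G) :
    handle (Function.update X (Gen.b i) y) = Function.update (handle X) i ⁅X (Gen.a i), y⁆ := by
  ext k
  rcases eq_or_ne k i with rfl | hk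
  · simp [handle, Gen.a, Gen.b]
  · simp [handle, Gen.a, Gen.b, hk]

/-- Effect on the relator of a multiplication of `a_i` by `e`. -/
theorem lift_update_a (X : Gen g p → G) (hX : FreeGroup.lift X (relator g p) = 1) (i : Fin g)
    (e : G) :
    FreeGroup.lift (Function.update X (Gen.a i) (e * X (Gen.a i))) (relator g p) =
      handlePrefix X i * e * (handlePrefix X i)⁻¹ *
        ((handlePrefix X i * (X (Gen.a i) * X (Gen.b i) * (X (Gen.a i))⁻¹)) * e⁻¹ *
          (handlePrefix X i * (X (Gen.a i) * X (Gen.b i) * (X (Gen.a i))⁻¹))⁻¹) := by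
  have hc : (fun j => Function.update X (Gen.a i) (e * X (Gen.a i)) (Gen.c j)) =
      fun j => X (Gen.c j) := by
    ext j; simp [Gen.a, Gen.c]
  rw [lift_relator, prod_ofFn_eq _ i] at hX
  rw [lift_relator, hc, handle_update_a, prod_ofFn_update]
  -- The relation expresses the puncture product through the commutators, so everything after the
  -- `i`-th handle cancels and only its prefix survives.
  rw [eq_inv_of_mul_eq_one_right hX]
  simp only [handle, handlePrefix, commutatorElement_def]
  group

/-- Effect on the relator of a multiplication of `b_i` by `e`. -/
theorem lift_update_b (X : Gen g p → G) (hX : FreeGroup.lift X (relator g p) = 1) (i : Fin g)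
    (e : G) :
    FreeGroup.lift (Function.update X (Gen.b i) (e * X (Gen.b i))) (relator g p) =
      (handlePrefix X i * X (Gen.a i)) * e * (handlePrefix X i * X (Gen.a i))⁻¹ *
        ((handlePrefix X i * handle X i) * e⁻¹ * (handlePrefix X i * handle X i)⁻¹) := by
  have hc : (fun j => Function.update X (Gen.b i) (e * X (Gen.b i)) (Gen.c j)) =
      fun j => X (Gen.c j) := by
    ext j; simp [Gen.b, Gen.c]
  rw [lift_relator, prod_ofFn_eq _ i] at hX
  rw [lift_relator, hc, handle_update_b, prod_ofFn_update, eq_inv_of_mul_eq_one_right hX]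
  simp only [handle, handlePrefix, commutatorElement_def]
  group

/-- Effect on the relator of a conjugation of `c_j` by `e`. -/
theorem lift_update_c (X : Gen g p → G) (hX : FreeGroup.lift X (relator g p) = 1) (j : Fin p)
    (e : G) :
    FreeGroup.lift (Function.update X (Gen.c j) (e * X (Gen.c j) * e⁻¹)) (relator g p) =
      puncturePrefix X j * e * (puncturePrefix X j)⁻¹ *
        ((puncturePrefix X j * X (Gen.c j)) * e⁻¹ * (puncturePrefix X j * X (Gen.c j))⁻¹) := by
  have hh : handle (Function.update X (Gen.c j) (e * X (Gen.c j) * e⁻¹)) = handle X := by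
    ext k; simp [handle, Gen.a, Gen.b, Gen.c]
  have hc : (fun k => Function.update X (Gen.c j) (e * X (Gen.c j) * e⁻¹) (Gen.c k)) =
      Function.update (fun k => X (Gen.c k)) j (e * X (Gen.c j) * e⁻¹) := by
    ext k
    rcases eq_or_ne k j with rfl | hk
    · simp
    · simp [Gen.c, hk]
  rw [lift_relator, prod_ofFn_eq _ j, ← mul_assoc, ← mul_assoc] at hX
  rw [lift_relator, hh, hc, prod_ofFn_update, eq_inv_of_mul_eq_one_right hX]
  simp only [puncturePrefix]
  group

/-- A subgroup contains all generators if it contains the quotients of the pairs of elements by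
which variations of the single generators conjugate. -/
theorem forall_mem_of_variations (X : Gen g p → G) (C : Subgroup G)
    (ha : ∀ i, handlePrefix X i * (X (Gen.a i) * X (Gen.b i) * (X (Gen.a i))⁻¹) *
      (handlePrefix X i)⁻¹ ∈ C)
    (hb : ∀ i, handlePrefix X i * handle X i * (handlePrefix X i * X (Gen.a i))⁻¹ ∈ C)
    (hc : ∀ j, puncturePrefix X j * X (Gen.c j) * (puncturePrefix X j)⁻¹ ∈ C) :
    ∀ s, X s ∈ C := by
  have conj_mem : ∀ {u y : G}, u ∈ C → u * y * u⁻¹ ∈ C → y ∈ C := fun {u y} hu h => by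
    rwa [C.mul_mem_cancel_right (C.inv_mem hu), C.mul_mem_cancel_left hu] at h
  have hab : ∀ n : ℕ, ∀ i : Fin g, (i : ℕ) = n → X (Gen.a i) ∈ C ∧ X (Gen.b i) ∈ C := by
    intro n
    induction n using Nat.strong_induction_on with
    | _ n ih =>
      rintro i rfl
      have hu : handlePrefix X i ∈ C := by
        refine prod_take_ofFn_mem C _ _ fun k hk => ?_
        obtain ⟨h1, h2⟩ := ih k hk k rfl
        exact C.mul_mem (C.mul_mem (C.mul_mem h1 h2) (C.inv_mem h1)) (C.inv_mem h2)
      have h1 := conj_mem hu (ha i)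
      have h2 := hb i
      rw [_root_.mul_inv_rev, ← mul_assoc, mul_assoc (handlePrefix X i)] at h2
      have h3 := conj_mem hu h2
      -- With the prefix in `C` by induction, `a b a⁻¹` and `[a, b] a⁻¹` lie in `C`. Their quotient
      -- gives `a b`, then `a b a⁻¹` gives `a`, and finally `b`.
      rw [handle, commutatorElement_def, mul_assoc, C.mul_mem_cancel_left h1, ← _root_.mul_inv_rev] at h3
      have h4 := (C.mul_mem_cancel_left (C.inv_mem_iff.1 h3)).1 h1
      have h5 := C.inv_mem_iff.1 h4
      exact ⟨h5, (C.mul_mem_cancel_left h5).1 (C.inv_mem_iff.1 h3)⟩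
  have hH : (List.ofFn (handle X)).prod ∈ C := by
    refine C.list_prod_mem fun y hy => ?_
    obtain ⟨k, rfl⟩ := (List.mem_ofFn' _ _).1 hy
    obtain ⟨h1, h2⟩ := hab k k rfl
    exact C.mul_mem (C.mul_mem (C.mul_mem h1 h2) (C.inv_mem h1)) (C.inv_mem h2)
  have hcc : ∀ n : ℕ, ∀ j : Fin p, (j : ℕ) = n → X (Gen.c j) ∈ C := by
    intro n
    induction n using Nat.strong_induction_on with
    | _ n ih =>
      rintro j rfl
      have hu : puncturePrefix X j ∈ C :=
        C.mul_mem hH (prod_take_ofFn_mem C _ _ fun k hk => ih k hk k rfl)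
      exact conj_mem hu (hc j)
  rintro (i | i | j)
  · exact (hab i i rfl).1
  · exact (hab i i rfl).2
  · exact hcc j j rfl

end Relator

/-! ### Words as polynomial functions of the matrix entries -/

section Words

variable {g p : ℕ}

/-- The matrix of a letter; inverses are replaced by adjugates. -/
def letterVal (x : MatTuples g p) (l : Gen g p × Bool) : M₃ :=
  cond l.2 (Matrix.of (x l.1)) (adjugate (Matrix.of (x l.1)))

/-- The value of a word at a tuple of matrices; inverses are replaced by adjugates. -/
def wordVal (x : MatTuples g p) (L : List (Gen g p × Bool)) : M₃ :=
  (L.map (letterVal x)).prod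

/-- The value of the relator at a tuple of matrices. -/
def relatorVal (x : MatTuples g p) : M₃ := wordVal x (relator g p).toWord

/-- The matrix entries of a tuple of elements of `SL₃(ℝ)`. -/
def slEntries (X : Gen g p → SL(3, ℝ)) : MatTuples g p := fun s i j => (X s : M₃) i j

theorem of_slEntries (X : Gen g p → SL(3, ℝ)) (s : Gen g p) :
    Matrix.of (slEntries X s) = (X s : M₃) := rfl

theorem wordVal_slEntries (X : Gen g p → SL(3, ℝ)) (L : List (Gen g p × Bool)) :
    wordVal (slEntries X) L = (FreeGroup.lift X (FreeGroup.mk L) : M₃) := by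
  rw [FreeGroup.lift_mk]
  induction L with
  | nil => rfl
  | cons l L ih =>
    rw [List.map_cons, List.prod_cons, Matrix.SpecialLinearGroup.coe_mul, ← ih]
    change letterVal (slEntries X) l * wordVal (slEntries X) L = _
    congr 1
    rcases l with ⟨s, _ | _⟩
    · simp [letterVal, of_slEntries, Matrix.SpecialLinearGroup.coe_inv]
    · simp [letterVal, of_slEntries]

theorem relatorVal_slEntries (X : Gen g p → SL(3, ℝ)) :
    relatorVal (slEntries X) = (FreeGroup.lift X (relator g p) : M₃) := by
  rw [relatorVal, wordVal_slEntries, FreeGroup.mk_toWord]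

end Words

/-! ### Smoothness of matrix-valued maps -/

section Smooth

variable {E : Type*} [NormedAddCommGroup E] [NormedSpace ℝ E]

/-- Smoothness, on a set, of a map to matrices. -/
def SmoothEntriesOn (f : E → M₃) (D : Set E) : Prop :=
  ∀ i j, ContDiffOn ℝ ∞ (fun x => f x i j) D

variable {D : Set E} {f h : E → M₃}

theorem smoothEntriesOn_const (A : M₃) : SmoothEntriesOn (fun _ : E => A) D :=
  fun _ _ => contDiffOn_const

theorem SmoothEntriesOn.sub (hf : SmoothEntriesOn f D) (hh : SmoothEntriesOn h D) :
    SmoothEntriesOn (fun x => f x - h x) D :=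
  fun i j => (hf i j).sub (hh i j)

theorem SmoothEntriesOn.mul (hf : SmoothEntriesOn f D) (hh : SmoothEntriesOn h D) :
    SmoothEntriesOn (fun x => f x * h x) D := fun i j => by
  simp only [mul_apply]
  exact ContDiffOn.sum fun k _ => (hf i k).mul (hh k j)

theorem SmoothEntriesOn.det (hf : SmoothEntriesOn f D) :
    ContDiffOn ℝ ∞ (fun x => (f x).det) D := by
  simp only [det_fin_three]
  have := hf
  unfold SmoothEntriesOn at this
  fun_prop

theorem SmoothEntriesOn.trace (hf : SmoothEntriesOn f D) :
    ContDiffOn ℝ ∞ (fun x => (f x).trace) D :=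
  ContDiffOn.sum fun k _ => hf k k

theorem SmoothEntriesOn.adjugate (hf : SmoothEntriesOn f D) :
    SmoothEntriesOn (fun x => (f x).adjugate) D := fun i j => by
  simp only [adjugate_fin_three]
  have := hf
  unfold SmoothEntriesOn at this
  fin_cases i <;> fin_cases j <;> simp <;> fun_prop

theorem SmoothEntriesOn.mulVec (hf : SmoothEntriesOn f D) {v : E → Fin 3 → ℝ}
    (hv : ∀ i, ContDiffOn ℝ ∞ (fun x => v x i) D) (i : Fin 3) :
    ContDiffOn ℝ ∞ (fun x => (f x *ᵥ v x) i) D := by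
  simp only [Matrix.mulVec, dotProduct]
  exact ContDiffOn.sum fun k _ => (hf i k).mul (hv k)

theorem SmoothEntriesOn.modScalar (hf : SmoothEntriesOn f D) :
    ContDiffOn ℝ ∞ (fun x => modScalar (f x)) D := by
  have := hf
  unfold SmoothEntriesOn at this
  rw [contDiffOn_pi]
  intro k
  fin_cases k <;> simp [PuncturedSurface.modScalar] <;> fun_prop

variable {g p : ℕ}

theorem smoothEntriesOn_coord (s : Gen g p) (D : Set (MatTuples g p)) :
    SmoothEntriesOn (fun x : MatTuples g p => Matrix.of (x s)) D := fun i j => by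
  simp only [of_apply]
  fun_prop

theorem smoothEntriesOn_wordVal (L : List (Gen g p × Bool)) (D : Set (MatTuples g p)) :
    SmoothEntriesOn (fun x : MatTuples g p => wordVal x L) D := by
  induction L with
  | nil => exact smoothEntriesOn_const 1
  | cons l L ih =>
    have : SmoothEntriesOn (fun x : MatTuples g p => letterVal x l) D := by
      rcases l with ⟨s, _ | _⟩
      · exact (smoothEntriesOn_coord s D).adjugate
      · exact smoothEntriesOn_coord s D
    exact this.mul ih

end Smooth

/-! ### Curves of matrices and their derivatives -/

section Curves

/-- Differentiability at `0` of a curve of matrices. -/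
def DiffEntries (f : ℝ → M₃) : Prop := ∀ i j, DifferentiableAt ℝ (fun t => f t i j) 0

theorem diffEntries_const (A : M₃) : DiffEntries fun _ => A :=
  fun _ _ => differentiableAt_const _

theorem DiffEntries.mul {f h : ℝ → M₃} (hf : DiffEntries f) (hh : DiffEntries h) :
    DiffEntries fun t => f t * h t := fun i j => by
  simp only [mul_apply]
  exact DifferentiableAt.fun_sum fun k _ => (hf i k).mul (hh k j)

theorem diffEntries_add_smul (A B : M₃) : DiffEntries fun t => A + t • B := fun i j => by
  simp only [Matrix.add_apply, Matrix.smul_apply, smul_eq_mul]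
  fun_prop

theorem diffEntries_transvec (N : M₃) (hN : N * N = 0) :
    DiffEntries fun t => (transvec N hN t : M₃) := diffEntries_add_smul 1 N

theorem diffEntries_transvec_inv (N : M₃) (hN : N * N = 0) :
    DiffEntries fun t => ((transvec N hN t)⁻¹ : SL(3, ℝ)) := by
  simp only [coe_transvec_inv, sub_eq_add_neg, ← smul_neg]
  exact diffEntries_add_smul 1 (-N)

theorem hasDerivAt_modScalar {f : ℝ → M₃} {f' : M₃}
    (hf : ∀ i j, HasDerivAt (fun t => f t i j) (f' i j) 0) :
    HasDerivAt (fun t => modScalar (f t)) (modScalar f') 0 := by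
  rw [hasDerivAt_pi]
  intro k
  fin_cases k <;> simp only [modScalar, LinearMap.coe_mk, AddHom.coe_mk]
  exacts [hf _ _, hf _ _, hf _ _, hf _ _, hf _ _, hf _ _, (hf 0 0).sub (hf 1 1),
    (hf 1 1).sub (hf 2 2)]

theorem hasDerivAt_quadratic (A B D : M₃) (i j : Fin 3) :
    HasDerivAt (fun t : ℝ => (A + t • B + t ^ 2 • D) i j) (B i j) 0 := by
  simp only [Matrix.add_apply, Matrix.smul_apply, smul_eq_mul]
  have h1 := ((hasDerivAt_id (0 : ℝ)).mul_const (B i j)).const_add (A i j)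
  have h2 := ((hasDerivAt_id (0 : ℝ)).pow 2).mul_const (D i j)
  simpa using! h1.add h2

/-- The derivative of a product of conjugates of opposite transvections. -/
theorem hasDerivAt_conj_transvec (α β : SL(3, ℝ)) (N : M₃) (hN : N * N = 0) (i j : Fin 3) :
    HasDerivAt (fun t => ((α * transvec N hN t * α⁻¹ * (β * (transvec N hN t)⁻¹ * β⁻¹) :
      SL(3, ℝ)) : M₃) i j)
      (((α : M₃) * N * adjugate (α : M₃) - (β : M₃) * N * adjugate (β : M₃)) i j) 0 := by
  -- The inverse of `1 + t N` is `1 - t N`, so the product is exactly quadratic in `t`, and the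
  -- derivative is its linear coefficient.
  have h : ∀ t : ℝ, ((α * transvec N hN t * α⁻¹ * (β * (transvec N hN t)⁻¹ * β⁻¹) :
      SL(3, ℝ)) : M₃) = 1 + t • ((α : M₃) * N * adjugate (α : M₃) -
        (β : M₃) * N * adjugate (β : M₃)) +
        t ^ 2 • (-((α : M₃) * N * adjugate (α : M₃) * ((β : M₃) * N * adjugate (β : M₃)))) := by
    intro t
    simp only [Matrix.SpecialLinearGroup.coe_mul, coe_transvec, coe_transvec_inv]
    rw [Matrix.SpecialLinearGroup.coe_inv, Matrix.SpecialLinearGroup.coe_inv]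
    simp only [mul_add, add_mul, mul_sub, sub_mul, mul_one, one_mul, coe_mul_adjugate,
      mul_smul_comm, smul_mul_assoc, smul_add, smul_sub, smul_smul, pow_two, smul_neg]
    abel
  simp only [h]
  exact hasDerivAt_quadratic _ _ _ i j

end Curves

/-! ### Irreducibility, Schur's lemma, and commutants -/

section Representation

variable {G : Type*} [Group G]

theorem linearRep_apply (ρ : G →* SL(3, ℝ)) (γ : G) (v : Fin 3 → ℝ) :
    linearRep ρ γ v = (ρ γ : M₃) *ᵥ v := rfl

theorem span_orbit_eq_top {ρ : G →* SL(3, ℝ)} (hρ : (linearRep ρ).IsIrreducible)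
    {v : Fin 3 → ℝ} (hv : v ≠ 0) :
    Submodule.span ℝ (Set.range fun γ => (ρ γ : M₃) *ᵥ v) = ⊤ := by
  let S : Subrepresentation (linearRep ρ) :=
    { toSubmodule := Submodule.span ℝ (Set.range fun γ => (ρ γ : M₃) *ᵥ v)
      apply_mem_toSubmodule := fun γ u hu => by
        have h : Submodule.span ℝ (Set.range fun γ => (ρ γ : M₃) *ᵥ v) ≤
            (Submodule.span ℝ (Set.range fun γ => (ρ γ : M₃) *ᵥ v)).comap (linearRep ρ γ) := by
          rw [Submodule.span_le]
          rintro _ ⟨δ, rfl⟩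
          refine Submodule.subset_span ⟨γ * δ, ?_⟩
          change (ρ (γ * δ) : M₃) *ᵥ v = (ρ γ : M₃) *ᵥ ((ρ δ : M₃) *ᵥ v)
          rw [mulVec_mulVec, map_mul, Matrix.SpecialLinearGroup.coe_mul]
        exact h hu }
  have hvS : v ∈ S.toSubmodule := Submodule.subset_span ⟨1, by simp⟩
  rcases hρ.eq_bot_or_eq_top S with h | h
  · rw [h] at hvS
    exact absurd ((Submodule.mem_bot ℝ).1 hvS) hv
  · exact congrArg Subrepresentation.toSubmodule h

theorem IsParabolic.sub_one_mulVec {c : SL(3, ℝ)} (hc : IsParabolic c) (e : Fin 3 → ℝ) :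
    ((c : M₃) - 1) *ᵥ (((c : M₃) - 1) ^ 2 *ᵥ e) = 0 := by
  rw [mulVec_mulVec, ← pow_succ', hc.sub_one_pow_three, zero_mulVec]

/-- If the orbit of a vector fixed by a parabolic element spans, the representation is
irreducible. -/
theorem isIrreducible_of_span {ρ : G →* SL(3, ℝ)} {γ₀ : G} (hc : IsParabolic (ρ γ₀))
    {v : Fin 3 → ℝ} (hv : ((ρ γ₀ : M₃) - 1) *ᵥ v = 0)
    (hspan : ⊤ ≤ Submodule.span ℝ (Set.range fun γ => (ρ γ : M₃) *ᵥ v)) :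
    (linearRep ρ).IsIrreducible := by
  have hnt : Nontrivial (Subrepresentation (linearRep ρ)) :=
    ⟨⊥, ⊤, fun h => bot_ne_top (α := Submodule ℝ (Fin 3 → ℝ))
      (congrArg Subrepresentation.toSubmodule h)⟩
  refine { toNontrivial := hnt, eq_bot_or_eq_top := fun S => or_iff_not_imp_left.2 fun hS => ?_ }
  have hS' : S.toSubmodule ≠ ⊥ := fun h => hS (Subrepresentation.toSubmodule_injective h)
  obtain ⟨w, hw, hw0⟩ := Submodule.exists_mem_ne_zero_of_ne_bot hS'
  set n : M₃ := (ρ γ₀ : M₃) - 1 with hn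
  have hnS : ∀ u ∈ S.toSubmodule, n *ᵥ u ∈ S.toSubmodule := fun u hu => by
    rw [hn, sub_mulVec, one_mulVec]
    exact S.toSubmodule.sub_mem (S.apply_mem_toSubmodule γ₀ hu) hu
  -- The nilpotent `n` preserves the nonzero invariant subspace, hence kills a nonzero vector in it.
  -- The fixed space being a line, the subspace contains `v` and its whole orbit.
  obtain ⟨u, hu, hu0, hnu⟩ : ∃ u ∈ S.toSubmodule, u ≠ 0 ∧ n *ᵥ u = 0 := by
    by_cases h1 : n *ᵥ w = 0
    · exact ⟨w, hw, hw0, h1⟩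
    by_cases h2 : n *ᵥ (n *ᵥ w) = 0
    · exact ⟨_, hnS _ hw, h1, h2⟩
    · refine ⟨_, hnS _ (hnS _ hw), h2, ?_⟩
      have := hc.sub_one_mulVec w
      rwa [pow_two, ← mulVec_mulVec] at this
  obtain ⟨μ, hμ⟩ := hc.exists_eq_smul hv hnu hu0
  have hvS : v ∈ S.toSubmodule := hμ ▸ S.toSubmodule.smul_mem μ hu
  refine Subrepresentation.toSubmodule_injective (top_le_iff.1 (hspan.trans ?_))
  rw [Submodule.span_le]
  rintro _ ⟨γ, rfl⟩
  exact S.apply_mem_toSubmodule γ hvS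

/-- Over `ℝ`, Schur's lemma alone yields only a division algebra. The parabolic element supplies a
real eigenvector: `A` preserves its fixed line, and the corresponding `A - μ` kills an orbit that
spans. -/
theorem eq_smul_one_of_commute {ρ : G →* SL(3, ℝ)} (hρ : (linearRep ρ).IsIrreducible) {γ₀ : G}
    (hc : IsParabolic (ρ γ₀)) {A : M₃} (hA : ∀ γ, A * (ρ γ : M₃) = ρ γ * A) :
    ∃ μ : ℝ, A = μ • (1 : M₃) := by
  obtain ⟨e, he⟩ := exists_mulVec_ne_zero hc.sub_one_pow_two_ne_zero
  have hv := hc.sub_one_mulVec e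
  set v := ((ρ γ₀ : M₃) - 1) ^ 2 *ᵥ e
  have hAv : ((ρ γ₀ : M₃) - 1) *ᵥ (A *ᵥ v) = 0 := by
    rw [mulVec_mulVec, sub_mul, one_mul, ← hA, ← mul_sub_one, ← mulVec_mulVec, hv, mulVec_zero]
  obtain ⟨μ, hμ⟩ := hc.exists_eq_smul hAv hv he
  refine ⟨μ, ?_⟩
  have hle : Submodule.span ℝ (Set.range fun γ => (ρ γ : M₃) *ᵥ v) ≤
      LinearMap.ker (Matrix.toLin' (A - μ • (1 : M₃))) := by
    rw [Submodule.span_le]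
    rintro _ ⟨γ, rfl⟩
    simp only [SetLike.mem_coe, LinearMap.mem_ker, toLin'_apply]
    rw [mulVec_mulVec, sub_mul, hA, smul_mul_assoc, one_mul, sub_mulVec, ← mulVec_mulVec, hμ,
      mulVec_smul, smul_mulVec, sub_self]
  rw [span_orbit_eq_top hρ he, top_le_iff, LinearMap.ker_eq_top] at hle
  exact sub_eq_zero.1 (Matrix.toLin'.map_eq_zero_iff.1 hle)

/-- The elements of `SL₃(ℝ)` that commute with a given matrix. -/
def commutant (A : M₃) : Subgroup SL(3, ℝ) where
  carrier := {h | A * (h : M₃) = h * A}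
  one_mem' := by simp
  mul_mem' {h k} hh hk := by
    simp only [Set.mem_ofPred_eq, Matrix.SpecialLinearGroup.coe_mul] at *
    rw [← mul_assoc, hh, mul_assoc, hk, mul_assoc]
  inv_mem' {h} hh := by
    simp only [Set.mem_ofPred_eq, Matrix.SpecialLinearGroup.coe_inv] at *
    have h1 := congrArg (fun M => adjugate (h : M₃) * M * adjugate (h : M₃)) hh
    simp only [mul_assoc, coe_mul_adjugate, mul_one] at h1
    simp only [← mul_assoc, adjugate_mul_coe, one_mul] at h1
    exact h1.symm

theorem mem_commutant_iff {A : M₃} {h : SL(3, ℝ)} : h ∈ commutant A ↔ A * (h : M₃) = h * A :=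
  Iff.rfl

/-- Cyclicity of the trace turns the hypothesis into orthogonality of the traceless matrix `α⁻¹ A α
- β⁻¹ A β` to all matrices of square zero. It therefore vanishes, which is the commutation. -/
theorem mul_inv_mem_commutant {A : M₃} {α β : SL(3, ℝ)}
    (h : ∀ N : M₃, N * N = 0 → (A * ((α : M₃) * N * adjugate (α : M₃) -
      (β : M₃) * N * adjugate (β : M₃))).trace = 0) : β * α⁻¹ ∈ commutant A := by
  have hz : adjugate (α : M₃) * A * α - adjugate (β : M₃) * A * β = 0 := by
    refine eq_zero_of_trace_mul ?_ fun N hN => ?_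
    · rw [trace_sub, trace_mul_comm, ← mul_assoc, coe_mul_adjugate, one_mul, trace_mul_comm,
        ← mul_assoc, coe_mul_adjugate, one_mul, sub_self]
    · rw [← h N hN, sub_mul, mul_sub, trace_sub, trace_sub]
      congr 1
      · rw [mul_assoc, mul_assoc, trace_mul_comm, mul_assoc, mul_assoc]
      · rw [mul_assoc, mul_assoc, trace_mul_comm, mul_assoc, mul_assoc]
  have h1 := congrArg (fun M => (β : M₃) * M * adjugate (α : M₃)) (sub_eq_zero.1 hz)
  simp only [mul_assoc, coe_mul_adjugate, mul_one] at h1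
  simp only [← mul_assoc, coe_mul_adjugate, one_mul] at h1
  rw [mem_commutant_iff, Matrix.SpecialLinearGroup.coe_mul, Matrix.SpecialLinearGroup.coe_inv, h1,
    mul_assoc]

theorem isIrreducible_conj {ρ ρ' : G →* SL(3, ℝ)} (hρ : (linearRep ρ).IsIrreducible)
    (h : SL(3, ℝ)) (hh : ∀ γ, ρ' γ = h * ρ γ * h⁻¹) : (linearRep ρ').IsIrreducible := by
  have hnt : Nontrivial (Subrepresentation (linearRep ρ')) :=
    ⟨⊥, ⊤, fun h => bot_ne_top (α := Submodule ℝ (Fin 3 → ℝ))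
      (congrArg Subrepresentation.toSubmodule h)⟩
  refine { toNontrivial := hnt, eq_bot_or_eq_top := fun S => ?_ }
  let S' : Subrepresentation (linearRep ρ) :=
    { toSubmodule := S.toSubmodule.comap (Matrix.toLin' (h : M₃))
      apply_mem_toSubmodule := fun γ u hu => by
        have h1 := S.apply_mem_toSubmodule γ hu
        rw [linearRep_apply, toLin'_apply, mulVec_mulVec, hh, coe_conj, mul_assoc,
          adjugate_mul_coe, mul_one, ← mulVec_mulVec] at h1
        exact h1 }
  have hmem : ∀ u, u ∈ S.toSubmodule ↔ adjugate (h : M₃) *ᵥ u ∈ S'.toSubmodule := fun u => by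
    change _ ↔ Matrix.toLin' (h : M₃) (adjugate (h : M₃) *ᵥ u) ∈ S.toSubmodule
    rw [toLin'_apply, mulVec_mulVec, coe_mul_adjugate, one_mulVec]
  refine (hρ.eq_bot_or_eq_top S').imp (fun h0 => ?_) fun h1 => ?_
  · refine Subrepresentation.toSubmodule_injective (le_bot_iff.1 fun u hu => ?_)
    rw [hmem, h0] at hu
    have h2 := congrArg (fun v => (h : M₃) *ᵥ v) ((Submodule.mem_bot ℝ).1 hu)
    simp only [mulVec_mulVec, coe_mul_adjugate, one_mulVec, mulVec_zero] at h2
    exact (Submodule.mem_bot ℝ).2 h2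
  · refine Subrepresentation.toSubmodule_injective (top_le_iff.1 fun u _ => ?_)
    rw [hmem, h1]
    trivial

end Representation

/-! ### Representations as tuples, and conjugation -/

namespace HomPIrr

variable {g p : ℕ}

/-- The images of the standard generators. -/
def tuple (ρ : HomPIrr g p) (s : Gen g p) : SL(3, ℝ) := ρ.1 (gen s)

theorem entries_eq (ρ : HomPIrr g p) : entries ρ = slEntries ρ.tuple := rfl

theorem lift_tuple (ρ : HomPIrr g p) (w : FreeGroup (Gen g p)) :
    FreeGroup.lift ρ.tuple w = ρ.1 (PresentedGroup.mk _ w) := by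
  have : FreeGroup.lift ρ.tuple = ρ.1.comp (PresentedGroup.mk {relator g p}) := by
    ext s
    simp [tuple, gen, PresentedGroup.of]
  rw [this]; rfl

theorem lift_tuple_relator (ρ : HomPIrr g p) : FreeGroup.lift ρ.tuple (relator g p) = 1 := by
  rw [lift_tuple, PresentedGroup.one_of_mem (Set.mem_singleton _), map_one]

theorem wordVal_entries (ρ : HomPIrr g p) (L : List (Gen g p × Bool)) :
    wordVal (entries ρ) L = (ρ.1 (PresentedGroup.mk _ (FreeGroup.mk L)) : M₃) := by
  rw [entries_eq, wordVal_slEntries, lift_tuple]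

theorem relatorVal_entries (ρ : HomPIrr g p) : relatorVal (entries ρ) = 1 := by
  rw [entries_eq, relatorVal_slEntries, lift_tuple_relator]; rfl

theorem isParabolic_tuple (ρ : HomPIrr g p) (j : Fin p) : IsParabolic (ρ.tuple (Gen.c j)) :=
  ρ.2.2 j

theorem forall_mem_of_tuple (ρ : HomPIrr g p) (C : Subgroup SL(3, ℝ)) (h : ∀ s, ρ.tuple s ∈ C)
    (γ : Pi1 g p) : ρ.1 γ ∈ C := by
  have h1 : (⊤ : Subgroup (Pi1 g p)) ≤ C.comap ρ.1 := by
    rw [← PresentedGroup.closure_range_of, Subgroup.closure_le]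
    rintro _ ⟨s, rfl⟩
    exact h s
  exact h1 (Subgroup.mem_top γ)

theorem ext_tuple {ρ ρ' : HomPIrr g p} (h : ∀ s, ρ.tuple s = ρ'.tuple s) : ρ = ρ' :=
  Subtype.ext (PresentedGroup.ext h)

theorem entries_injective : Function.Injective (entries : HomPIrr g p → MatTuples g p) :=
  fun _ _ h => ext_tuple fun s => Subtype.ext (Matrix.ext fun i j =>
    congrFun (congrFun (congrFun h s) i) j)

/-- The representation attached to a tuple of elements of `SL₃(ℝ)`. -/
def ofTuple (X : Gen g p → SL(3, ℝ)) (hX : FreeGroup.lift X (relator g p) = 1) :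
    Pi1 g p →* SL(3, ℝ) :=
  PresentedGroup.toGroup (f := X) (by rintro _ rfl; exact hX)

theorem ofTuple_gen (X : Gen g p → SL(3, ℝ)) (hX : FreeGroup.lift X (relator g p) = 1)
    (s : Gen g p) : ofTuple X hX (gen s) = X s :=
  PresentedGroup.toGroup.of _

end HomPIrr

variable {g p : ℕ}

namespace HomPIrr

/-- The conjugate of a representation. -/
def conj (h : SL(3, ℝ)) (ρ : HomPIrr g p) : HomPIrr g p :=
  ⟨(MulAut.conj h).toMonoidHom.comp ρ.1, isIrreducible_conj ρ.2.1 h fun _ => rfl, fun j =>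
    (ρ.2.2 j).trans (isConj_iff.2 ⟨h, rfl⟩)⟩

theorem conj_apply (h : SL(3, ℝ)) (ρ : HomPIrr g p) (γ : Pi1 g p) :
    (conj h ρ).1 γ = h * ρ.1 γ * h⁻¹ := rfl

theorem proj_conj (h : SL(3, ℝ)) (ρ : HomPIrr g p) : proj (conj h ρ) = proj ρ :=
  (Quotient.sound (s := conjSetoid g p) ⟨h, fun _ => rfl⟩).symm

theorem proj_eq_iff {ρ ρ' : HomPIrr g p} : proj ρ = proj ρ' ↔ ∃ h, ρ' = conj h ρ := by
  refine ⟨fun h => ?_, ?_⟩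
  · obtain ⟨k, hk⟩ := Quotient.exact (s := conjSetoid g p) h
    exact ⟨k, Subtype.ext (MonoidHom.ext hk)⟩
  · rintro ⟨h, rfl⟩
    exact (proj_conj h ρ).symm

theorem of_entries (ρ : HomPIrr g p) (s : Gen g p) :
    Matrix.of (entries ρ s) = (ρ.tuple s : M₃) := rfl

theorem of_entries_conj (h : SL(3, ℝ)) (ρ : HomPIrr g p) (s : Gen g p) :
    Matrix.of (entries (conj h ρ) s) = h * (ρ.tuple s : M₃) * adjugate (h : M₃) := by
  rw [of_entries, tuple, conj_apply, coe_conj]; rfl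

theorem wordVal_entries_conj (h : SL(3, ℝ)) (ρ : HomPIrr g p) (L : List (Gen g p × Bool)) :
    wordVal (entries (conj h ρ)) L = h * wordVal (entries ρ) L * adjugate (h : M₃) := by
  rw [wordVal_entries, wordVal_entries, conj_apply, coe_conj]

end HomPIrr

/-! ### Local equations and frames -/

section Equations

/-- The equations for determinants one and, at the punctures, for unipotence. -/
def localEq (x : MatTuples g p) : (Gen g p → ℝ) × (Fin p → ℝ) × (Fin p → ℝ) :=
  (fun s => (Matrix.of (x s)).det - 1, fun j => (Matrix.of (x (Gen.c j))).trace - 3,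
    fun j => (adjugate (Matrix.of (x (Gen.c j)))).trace - 3)

/-- The fixed vector of the `j`-th puncture. -/
def fixedVec (j : Fin p) (e : Fin 3 → ℝ) (x : MatTuples g p) : Fin 3 → ℝ :=
  (Matrix.of (x (Gen.c j)) - 1) ^ 2 *ᵥ e

/-- The matrix whose columns are the translates of the fixed vector of a puncture under three
words, normalized by a constant matrix. -/
def frame (j : Fin p) (w : Fin 3 → List (Gen g p × Bool)) (e : Fin 3 → ℝ) (C : M₃)
    (x : MatTuples g p) : M₃ :=
  (Matrix.of fun i k => (wordVal x (w k) *ᵥ fixedVec j e x) i) * C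

theorem localEq_slEntries {X : Gen g p → SL(3, ℝ)} (hX : ∀ j, IsParabolic (X (Gen.c j))) :
    localEq (slEntries X) = 0 := by
  simp only [localEq, of_slEntries, (hX _).trace_eq, (hX _).trace_adjugate_eq, sub_self,
    Matrix.SpecialLinearGroup.det_coe]
  rfl

theorem contDiff_localEq : ContDiff ℝ ∞ (localEq : MatTuples g p → _) := by
  rw [← contDiffOn_univ]
  refine ContDiffOn.prodMk ?_ (ContDiffOn.prodMk ?_ ?_)
  · exact contDiffOn_pi.2 fun s => (smoothEntriesOn_coord s _).det.sub contDiffOn_const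
  · exact contDiffOn_pi.2 fun s => (smoothEntriesOn_coord _ _).trace.sub contDiffOn_const
  · exact contDiffOn_pi.2 fun s => (smoothEntriesOn_coord _ _).adjugate.trace.sub contDiffOn_const

theorem contDiffOn_fixedVec (j : Fin p) (e : Fin 3 → ℝ) (D : Set (MatTuples g p)) (i : Fin 3) :
    ContDiffOn ℝ ∞ (fun x : MatTuples g p => fixedVec j e x i) D := by
  have h := (smoothEntriesOn_coord (Gen.c j : Gen g p) D).sub (smoothEntriesOn_const 1)
  simp only [fixedVec, pow_two]
  exact (h.mul h).mulVec (v := fun _ => e) (fun _ => contDiffOn_const) i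

theorem smoothEntriesOn_frame (j : Fin p) (w : Fin 3 → List (Gen g p × Bool)) (e : Fin 3 → ℝ)
    (C : M₃) (D : Set (MatTuples g p)) : SmoothEntriesOn (frame j w e C) D := by
  have h : SmoothEntriesOn (fun x : MatTuples g p =>
      (Matrix.of fun i k => (wordVal x (w k) *ᵥ fixedVec j e x) i : M₃)) D := fun i k =>
    (smoothEntriesOn_wordVal (w k) D).mulVec (contDiffOn_fixedVec j e D) i
  exact h.mul (smoothEntriesOn_const C)

theorem contDiff_modScalar_frame (j : Fin p) (w : Fin 3 → List (Gen g p × Bool)) (e : Fin 3 → ℝ)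
    (C : M₃) : ContDiff ℝ ∞ fun x : MatTuples g p => modScalar (frame j w e C x) :=
  contDiffOn_univ.1 (smoothEntriesOn_frame j w e C _).modScalar

theorem contDiff_modScalar_relatorVal :
    ContDiff ℝ ∞ fun x : MatTuples g p => modScalar (relatorVal x) :=
  contDiffOn_univ.1 (smoothEntriesOn_wordVal _ _).modScalar

theorem fixedVec_entries (j : Fin p) (e : Fin 3 → ℝ) (ρ : HomPIrr g p) :
    fixedVec j e (entries ρ) = ((ρ.tuple (Gen.c j) : M₃) - 1) ^ 2 *ᵥ e := rfl

theorem fixedVec_ne_zero_of_det {j : Fin p} {w : Fin 3 → List (Gen g p × Bool)} {e : Fin 3 → ℝ}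
    {C : M₃} {x : MatTuples g p} (h : (frame j w e C x).det ≠ 0) : fixedVec j e x ≠ 0 := by
  intro h0
  refine h ?_
  have : (Matrix.of fun i k => (wordVal x (w k) *ᵥ fixedVec j e x) i : M₃) = 0 := by
    ext i k
    simp [h0]
  rw [frame, this, zero_mul, det_zero]

/-- Frames are equivariant up to scale. -/
theorem exists_frame_conj (j : Fin p) (w : Fin 3 → List (Gen g p × Bool)) (e : Fin 3 → ℝ) (C : M₃)
    {ρ : HomPIrr g p} (hv : fixedVec j e (entries ρ) ≠ 0) (h : SL(3, ℝ)) :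
    ∃ μ : ℝ, frame j w e C (entries (ρ.conj h)) = μ • ((h : M₃) * frame j w e C (entries ρ)) := by
  have hc := ρ.isParabolic_tuple j
  have h1 : fixedVec j e (entries (ρ.conj h)) =
      (h : M₃) *ᵥ (((ρ.tuple (Gen.c j) : M₃) - 1) ^ 2 *ᵥ (adjugate (h : M₃) *ᵥ e)) := by
    have h2 : Matrix.of (entries (ρ.conj h) (Gen.c j)) - 1 =
        (h : M₃) * ((ρ.tuple (Gen.c j) : M₃) - 1) * adjugate (h : M₃) := by
      rw [HomPIrr.of_entries_conj, mul_sub, sub_mul, mul_one, coe_mul_adjugate]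
    rw [fixedVec, h2, mulVec_mulVec, mulVec_mulVec, pow_two, pow_two]
    simp only [mul_assoc]
    rw [← mul_assoc (adjugate (h : M₃)) (h : M₃), adjugate_mul_coe, one_mul]
  -- Both vectors lie on the fixed line of the puncture. Their ratio `μ`, possibly zero, is common
  -- to the three columns.
  obtain ⟨μ, hμ⟩ := hc.exists_eq_smul (hc.sub_one_mulVec (adjugate (h : M₃) *ᵥ e))
    (hc.sub_one_mulVec e) hv
  refine ⟨μ, ?_⟩
  rw [frame, frame, ← mul_assoc, ← smul_mul_assoc]
  congr 1
  ext i k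
  have h3 : wordVal (entries (ρ.conj h)) (w k) *ᵥ fixedVec j e (entries (ρ.conj h)) =
      μ • ((h : M₃) *ᵥ (wordVal (entries ρ) (w k) *ᵥ fixedVec j e (entries ρ))) := by
    rw [h1, hμ, HomPIrr.wordVal_entries_conj, mulVec_mulVec, mul_assoc, adjugate_mul_coe, mul_one,
      mulVec_smul, ← mulVec_mulVec]
    rfl
  rw [of_apply, h3]
  rfl

/-- The orbit of a fixed vector spans by irreducibility, so three words produce a basis; `C` is the
inverse of its matrix. -/
theorem exists_frame_eq_one (j : Fin p) (ρ : HomPIrr g p) :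
    ∃ w e C, frame j w e C (entries ρ) = 1 := by
  have hc := ρ.isParabolic_tuple j
  obtain ⟨e, he⟩ := exists_mulVec_ne_zero hc.sub_one_pow_two_ne_zero
  set v := ((ρ.tuple (Gen.c j) : M₃) - 1) ^ 2 *ᵥ e with hv
  have hspan := span_orbit_eq_top ρ.2.1 he
  have hrank : Module.finrank ℝ
      (Submodule.span ℝ (Set.range fun γ => (ρ.1 γ : M₃) *ᵥ v)) = 3 := by
    rw [hspan, finrank_top]; simp
  obtain ⟨f, hf, -, hlin⟩ := Submodule.exists_fun_fin_finrank_span_eq ℝ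
    (Set.range fun γ => (ρ.1 γ : M₃) *ᵥ v)
  obtain ⟨f, hf, hlin⟩ : ∃ f : Fin 3 → Fin 3 → ℝ,
      (∀ k, f k ∈ Set.range fun γ => (ρ.1 γ : M₃) *ᵥ v) ∧ LinearIndependent ℝ f :=
    ⟨f ∘ Fin.cast hrank.symm, fun k => hf _, hlin.comp _ (Fin.cast_injective _)⟩
  have hw : ∀ k, ∃ L : List (Gen g p × Bool), wordVal (entries ρ) L *ᵥ v = f k := fun k => by
    obtain ⟨γ, hγ⟩ := hf k
    obtain ⟨w, rfl⟩ := PresentedGroup.mk_surjective _ γ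
    refine ⟨w.toWord, ?_⟩
    rw [ρ.wordVal_entries, FreeGroup.mk_toWord, ← hγ]
  choose w hw using hw
  have hM : (Matrix.of fun i k => (wordVal (entries ρ) (w k) *ᵥ fixedVec j e (entries ρ)) i : M₃) =
      (Matrix.of f)ᵀ := by
    ext i k
    rw [of_apply, fixedVec_entries, ← hv, hw]; rfl
  have hdet : IsUnit ((Matrix.of f)ᵀ).det := by
    rw [det_transpose]
    exact (Matrix.isUnit_iff_isUnit_det _).1 (Matrix.linearIndependent_rows_iff_isUnit.1 hlin)
  refine ⟨w, e, ((Matrix.of f)ᵀ)⁻¹, ?_⟩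
  rw [frame, hM, Matrix.mul_nonsing_inv _ hdet]

end Equations

/-! ### Submersivity of the relator and of the frame -/

section Derivative

theorem fderiv_deriv_eq {E T : Type*} [NormedAddCommGroup E] [NormedSpace ℝ E]
    [NormedAddCommGroup T] [NormedSpace ℝ T] {f : E → T} {c : ℝ → E} {x : E} (hx : c 0 = x)
    (hf : DifferentiableAt ℝ f x) (hc : DifferentiableAt ℝ c 0) {y : T}
    (hy : HasDerivAt (fun t => f (c t)) y 0) : fderiv ℝ f x (deriv c 0) = y := by
  subst hx
  exact (hf.hasFDerivAt.comp_hasDerivAt 0 hc.hasDerivAt).unique hy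

theorem differentiableAt_slEntries {X : ℝ → Gen g p → SL(3, ℝ)}
    (hX : ∀ s, DiffEntries fun t => (X t s : M₃)) :
    DifferentiableAt ℝ (fun t => slEntries (X t)) 0 :=
  differentiableAt_pi.2 fun s => differentiableAt_pi.2 fun i => differentiableAt_pi.2 fun j =>
    hX s i j

theorem diffEntries_update {X : Gen g p → SL(3, ℝ)} (s : Gen g p) {y : ℝ → SL(3, ℝ)}
    (hy : DiffEntries fun t => (y t : M₃)) (s' : Gen g p) :
    DiffEntries fun t => (Function.update X s (y t) s' : M₃) := by
  rcases eq_or_ne s' s with rfl | hs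
  · simpa only [Function.update_self] using hy
  · simpa only [Function.update_of_ne hs] using diffEntries_const _

/-- A matrix orthogonal to the derivatives of the relator along the variations of the single
generators is zero. -/
theorem eq_zero_of_relator_variations (hp : 0 < p) (ρ : HomPIrr g p) {A : M₃} (htr : A.trace = 0)
    (h : ∀ (X : ℝ → Gen g p → SL(3, ℝ)) (B : M₃), X 0 = ρ.tuple →
      (∀ s, DiffEntries fun t => (X t s : M₃)) → (∀ t j, IsParabolic (X t (Gen.c j))) →
      (∀ i j, HasDerivAt (fun t => (FreeGroup.lift (X t) (relator g p) : M₃) i j) (B i j) 0) →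
      (A * B).trace = 0) : A = 0 := by
  have hrel := ρ.lift_tuple_relator
  have hcomm : ∀ s, ρ.tuple s ∈ commutant A := by
    refine forall_mem_of_variations ρ.tuple (commutant A) (fun i => ?_) (fun i => ?_) fun j => ?_
    · refine mul_inv_mem_commutant fun N hN => ?_
      refine h (fun t => Function.update ρ.tuple (Gen.a i)
        (transvec N hN t * ρ.tuple (Gen.a i))) _ ?_ ?_ ?_ ?_
      · simp only [transvec_zero, one_mul, Function.update_eq_self]
      · refine diffEntries_update _ ?_
        simp only [Matrix.SpecialLinearGroup.coe_mul]
        exact (diffEntries_transvec N hN).mul (diffEntries_const _)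
      · intro t j
        have : (Gen.c j : Gen g p) ≠ Gen.a i := by simp [Gen.a, Gen.c]
        rw [Function.update_of_ne this]
        exact ρ.isParabolic_tuple j
      · simp only [lift_update_a _ hrel]
        exact hasDerivAt_conj_transvec _ _ N hN
    · refine mul_inv_mem_commutant fun N hN => ?_
      refine h (fun t => Function.update ρ.tuple (Gen.b i)
        (transvec N hN t * ρ.tuple (Gen.b i))) _ ?_ ?_ ?_ ?_
      · simp only [transvec_zero, one_mul, Function.update_eq_self]
      · refine diffEntries_update _ ?_
        simp only [Matrix.SpecialLinearGroup.coe_mul]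
        exact (diffEntries_transvec N hN).mul (diffEntries_const _)
      · intro t j
        have : (Gen.c j : Gen g p) ≠ Gen.b i := by simp [Gen.b, Gen.c]
        rw [Function.update_of_ne this]
        exact ρ.isParabolic_tuple j
      · simp only [lift_update_b _ hrel]
        exact hasDerivAt_conj_transvec _ _ N hN
    · refine mul_inv_mem_commutant fun N hN => ?_
      -- A puncture generator is varied by conjugation, unlike the handle generators, in order to
      -- remain parabolic.
      refine h (fun t => Function.update ρ.tuple (Gen.c j)
        (transvec N hN t * ρ.tuple (Gen.c j) * (transvec N hN t)⁻¹)) _ ?_ ?_ ?_ ?_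
      · simp only [transvec_zero, one_mul, inv_one, mul_one, Function.update_eq_self]
      · refine diffEntries_update _ ?_
        simp only [Matrix.SpecialLinearGroup.coe_mul]
        exact ((diffEntries_transvec N hN).mul (diffEntries_const _)).mul
          (diffEntries_transvec_inv N hN)
      · intro t k
        rcases eq_or_ne (Gen.c k : Gen g p) (Gen.c j) with hk | hk
        · rw [hk, Function.update_self]
          exact (ρ.isParabolic_tuple j).trans (isConj_iff.2 ⟨_, rfl⟩)
        · rw [Function.update_of_ne hk]
          exact ρ.isParabolic_tuple k
      · simp only [lift_update_c _ hrel]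
        exact hasDerivAt_conj_transvec _ _ N hN
  obtain ⟨μ, rfl⟩ := eq_smul_one_of_commute ρ.2.1 (ρ.isParabolic_tuple ⟨0, hp⟩)
    (ρ.forall_mem_of_tuple _ hcomm)
  have hμ : μ = 0 := by simpa using htr
  rw [hμ, zero_smul]

theorem surjective_of_forall_dual {K V : Type*} [AddCommGroup K] [Module ℝ K] [AddCommGroup V]
    [Module ℝ V] (L : K →ₗ[ℝ] V) (h : ∀ f : V →ₗ[ℝ] ℝ, (∀ k, f (L k) = 0) → f = 0) :
    Function.Surjective L := by
  rw [← LinearMap.range_eq_top]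
  by_contra hne
  obtain ⟨f, hf, hle⟩ := Submodule.exists_le_ker_of_lt_top _ (lt_top_iff_ne_top.2 hne)
  exact hf (h f fun k => hle ⟨k, rfl⟩)

theorem eq_zero_of_comp_modScalar {f : (Fin 8 → ℝ) →ₗ[ℝ] ℝ} (h : ∀ M, f (modScalar M) = 0) :
    f = 0 := by
  refine LinearMap.ext fun y => ?_
  obtain ⟨M, rfl⟩ := modScalar_surjective y
  exact h M

/-- The derivative of the relator is onto, modulo scalars, on the kernel of the derivative of the
local equations. -/
theorem exists_fderiv_relatorVal_eq (hp : 0 < p) (ρ : HomPIrr g p) (z : Fin 8 → ℝ) :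
    ∃ u : MatTuples g p, fderiv ℝ localEq (entries ρ) u = 0 ∧
      fderiv ℝ (fun x : MatTuples g p => modScalar (relatorVal x)) (entries ρ) u = z := by
  set L := fderiv ℝ (fun x : MatTuples g p => modScalar (relatorVal x)) (entries ρ)
  set K := LinearMap.ker (fderiv ℝ (localEq : MatTuples g p → _) (entries ρ)).toLinearMap
  have hsurj : Function.Surjective (L.toLinearMap ∘ₗ K.subtype) := by
    refine surjective_of_forall_dual _ fun f hf => eq_zero_of_comp_modScalar fun M => ?_
    -- A linear form that kills the image is the trace pairing with some `A`, traceless because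
    -- `modScalar` kills the identity.
    obtain ⟨A, hA⟩ := exists_trace_mul_eq (f ∘ₗ modScalar)
    have htr : A.trace = 0 := by
      have := hA 1
      rwa [LinearMap.comp_apply, modScalar_one, map_zero, mul_one, eq_comm] at this
    have hA0 : A = 0 := by
      refine eq_zero_of_relator_variations hp ρ htr fun X B hX0 hX hpar hB => ?_
      have hx : slEntries (X 0) = entries ρ := by rw [hX0, ρ.entries_eq]
      have hd := differentiableAt_slEntries hX
      have h1 : fderiv ℝ localEq (entries ρ) (deriv (fun t => slEntries (X t)) 0) = 0 := by
        refine fderiv_deriv_eq hx (contDiff_localEq.differentiable (by simp) _) hd ?_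
        simp only [localEq_slEntries (hpar _)]
        exact hasDerivAt_const _ _
      have h2 : L (deriv (fun t => slEntries (X t)) 0) = modScalar B := by
        refine fderiv_deriv_eq hx
          (contDiff_modScalar_relatorVal.differentiable (by simp) _) hd ?_
        simp only [relatorVal_slEntries]
        exact hasDerivAt_modScalar hB
      have h3 := hf ⟨_, h1⟩
      rw [← hA, LinearMap.comp_apply, ← h2]
      exact h3
    rw [← LinearMap.comp_apply, hA, hA0, zero_mul, trace_zero]
  obtain ⟨u, hu⟩ := hsurj z
  exact ⟨u, u.2, hu⟩

/-- The derivative of the frame is onto, modulo scalars, on the tangent space of the orbit. -/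
theorem exists_fderiv_frame_eq (ρ : HomPIrr g p) {j : Fin p} {w : Fin 3 → List (Gen g p × Bool)}
    {e : Fin 3 → ℝ} {C : M₃} (hframe : frame j w e C (entries ρ) = 1) (z : Fin 8 → ℝ) :
    ∃ u : MatTuples g p, fderiv ℝ localEq (entries ρ) u = 0 ∧
      fderiv ℝ (fun x : MatTuples g p => modScalar (relatorVal x)) (entries ρ) u = 0 ∧
      fderiv ℝ (fun x : MatTuples g p => modScalar (frame j w e C x)) (entries ρ) u = z := by
  set L := fderiv ℝ (fun x : MatTuples g p => modScalar (frame j w e C x)) (entries ρ)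
  set K := LinearMap.ker (fderiv ℝ (localEq : MatTuples g p → _) (entries ρ)).toLinearMap ⊓
    LinearMap.ker
      (fderiv ℝ (fun x : MatTuples g p => modScalar (relatorVal x)) (entries ρ)).toLinearMap
  have hsurj : Function.Surjective (L.toLinearMap ∘ₗ K.subtype) := by
    refine surjective_of_forall_dual _ fun f hf => eq_zero_of_comp_modScalar fun M => ?_
    obtain ⟨A, hA⟩ := exists_trace_mul_eq (f ∘ₗ modScalar)
    have htr : A.trace = 0 := by
      have := hA 1
      rwa [LinearMap.comp_apply, modScalar_one, map_zero, mul_one, eq_comm] at this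
    have hA0 : A = 0 := by
      refine eq_zero_of_trace_mul htr fun N hN => ?_
      let c : ℝ → MatTuples g p := fun t => entries (ρ.conj (transvec N hN t))
      have hx : c 0 = entries ρ := by
        change entries (ρ.conj (transvec N hN 0)) = _
        rw [transvec_zero]
        congr 1
        exact HomPIrr.ext_tuple fun s => by simp [HomPIrr.tuple, HomPIrr.conj_apply]
      have hd : DifferentiableAt ℝ c 0 := by
        refine differentiableAt_slEntries
          (X := fun t => (ρ.conj (transvec N hN t)).tuple) fun s => ?_
        simp only [HomPIrr.tuple, HomPIrr.conj_apply, Matrix.SpecialLinearGroup.coe_mul]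
        exact ((diffEntries_transvec N hN).mul (diffEntries_const _)).mul
          (diffEntries_transvec_inv N hN)
      have h1 : fderiv ℝ localEq (entries ρ) (deriv c 0) = 0 := by
        refine fderiv_deriv_eq hx (contDiff_localEq.differentiable (by simp) _) hd ?_
        have : ∀ t, localEq (c t) = 0 := fun t => localEq_slEntries fun j =>
          (ρ.conj (transvec N hN t)).isParabolic_tuple j
        simp only [this]
        exact hasDerivAt_const _ _
      have h2 : fderiv ℝ (fun x : MatTuples g p => modScalar (relatorVal x)) (entries ρ)
          (deriv c 0) = 0 := by
        refine fderiv_deriv_eq hx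
          (contDiff_modScalar_relatorVal.differentiable (by simp) _) hd ?_
        simp only [c, HomPIrr.relatorVal_entries]
        exact hasDerivAt_const _ _
      have h3 : L (deriv c 0) = modScalar N := by
        refine fderiv_deriv_eq hx
          ((contDiff_modScalar_frame j w e C).differentiable (by simp) _) hd ?_
        have hv : fixedVec j e (entries ρ) ≠ 0 :=
          fixedVec_ne_zero_of_det (j := j) (w := w) (C := C) (by rw [hframe]; simp)
        -- Along the curve the frame is `μ(t) (1 + t N)`. Since `N` is traceless, `μ` is a third of
        -- the trace of the frame, hence differentiable with `μ(0) = 1`; modulo scalars there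
        -- remains `μ(t) t N`, with derivative `N`.
        choose μ hμ using fun t => exists_frame_conj j w e C hv (transvec N hN t)
        have hN0 := trace_eq_zero_of_mul_self hN
        have hμt : ∀ t, μ t = (frame j w e C (c t)).trace / 3 := fun t => by
          rw [hμ, hframe, mul_one, coe_transvec, trace_smul, trace_add, trace_smul, hN0]
          simp
        have hdiff : DifferentiableAt ℝ μ 0 := by
          have h4 : ContDiff ℝ ∞ fun x : MatTuples g p => (frame j w e C x).trace :=
            contDiffOn_univ.1 (smoothEntriesOn_frame j w e C _).trace
          have h5 := ((h4.differentiable (by simp)).differentiableAt.comp (0 : ℝ) hd).div_const 3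
          exact h5.congr_of_eventuallyEq (Filter.Eventually.of_forall hμt)
        have hμ0 : μ 0 = 1 := by
          rw [hμt, hx, hframe]; simp
        have h6 : ∀ t, modScalar (frame j w e C (c t)) = (μ t * t) • modScalar N := fun t => by
          rw [hμ, hframe, mul_one, coe_transvec, map_smul, map_add, modScalar_one, zero_add,
            map_smul, smul_smul]
        simp only [h6]
        have h7 := (hdiff.hasDerivAt.mul (hasDerivAt_id (0 : ℝ))).smul_const (modScalar N)
        simpa [hμ0] using! h7
      have h8 := hf ⟨_, h1, h2⟩
      rw [← hA, LinearMap.comp_apply, ← h3]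
      exact h8
    rw [← LinearMap.comp_apply, hA, hA0, zero_mul, trace_zero]
  obtain ⟨u, hu⟩ := hsurj z
  exact ⟨u, u.2.1, u.2.2, hu⟩

end Derivative

/-! ### Submersivity of the local equations -/

section LocalEquations

/-- A direction at the Jordan block along which determinant, trace and trace of the adjugate have
prescribed derivatives. -/
def jordanDir (α β γ : ℝ) : M₃ := !![β, 0, 0; 2 * β - γ, 0, 0; α + β - γ, 0, 0]

/-- Only the first column is perturbed, so determinant, trace and trace of the adjugate are affine
in `t`. If `x, y, z` is that column, their slopes are `x - y + z`, `x` and `2x - y`, and `jordanDir`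
solves this system. -/
theorem det_jordanBlock_add (α β γ t : ℝ) :
    ((jordanBlock : M₃) + t • jordanDir α β γ).det = 1 + t * α := by
  rw [coe_jordanBlock, jordanDir, det_fin_three]
  simp
  ring

theorem trace_jordanBlock_add (α β γ t : ℝ) :
    ((jordanBlock : M₃) + t • jordanDir α β γ).trace = 3 + t * β := by
  rw [coe_jordanBlock, jordanDir]
  simp [trace, Fin.sum_univ_three]
  ring

theorem trace_adjugate_jordanBlock_add (α β γ t : ℝ) :
    (adjugate ((jordanBlock : M₃) + t • jordanDir α β γ)).trace = 3 + t * γ := by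
  rw [coe_jordanBlock, jordanDir, adjugate_fin_three]
  simp [trace, Fin.sum_univ_three]
  ring

theorem hasDerivAt_affine (a b : ℝ) : HasDerivAt (fun t : ℝ => a + t * b) b 0 := by
  simpa using ((hasDerivAt_id (0 : ℝ)).mul_const b).const_add a

/-- The local equations are submersive at every representation. -/
theorem exists_fderiv_localEq_eq (ρ : HomPIrr g p)
    (z : (Gen g p → ℝ) × (Fin p → ℝ) × (Fin p → ℝ)) :
    ∃ u : MatTuples g p, fderiv ℝ localEq (entries ρ) u = z := by
  obtain ⟨α, β, γ⟩ := z
  choose h hh using fun j => (ρ.isParabolic_tuple j).exists_eq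
  -- Handle generators carry only the determinant equation, so rescaling suffices: `(1 + t a / 3)³`
  -- has derivative `a` at 0. At punctures the direction is transported from the Jordan block.
  let B : Gen g p → M₃ := Sum.elim (fun i => (α (Gen.a i) / 3) • (ρ.tuple (Gen.a i) : M₃))
    (Sum.elim (fun i => (α (Gen.b i) / 3) • (ρ.tuple (Gen.b i) : M₃))
      fun j => (h j : M₃) * jordanDir (α (Gen.c j)) (β j) (γ j) * adjugate (h j : M₃))
  let c : ℝ → MatTuples g p := fun t s i j => ((ρ.tuple s : M₃) + t • B s) i j
  have hof : ∀ t s, Matrix.of (c t s) = (ρ.tuple s : M₃) + t • B s := fun t s => rfl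
  have hx : c 0 = entries ρ := by
    funext s i j
    simp [c, HomPIrr.entries_eq, slEntries]
  have hd : DifferentiableAt ℝ c 0 :=
    differentiableAt_pi.2 fun s => differentiableAt_pi.2 fun i => differentiableAt_pi.2 fun j =>
      diffEntries_add_smul _ _ i j
  have hcj : ∀ t j, Matrix.of (c t (Gen.c j)) = (h j : M₃) *
      ((jordanBlock : M₃) + t • jordanDir (α (Gen.c j)) (β j) (γ j)) * adjugate (h j : M₃) := by
    intro t j
    rw [hof, hh j, coe_conj, mul_add, add_mul, mul_smul_comm, smul_mul_assoc]
    rfl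
  have hscal : ∀ (s : Gen g p) (a t : ℝ),
      HasDerivAt (fun t : ℝ => ((ρ.tuple s : M₃) + t • ((a / 3) • (ρ.tuple s : M₃))).det - 1)
        a 0 := by
    intro s a t
    have h1 : ∀ t : ℝ, ((ρ.tuple s : M₃) + t • ((a / 3) • (ρ.tuple s : M₃))).det - 1 =
        (1 + t * (a / 3)) ^ 3 - 1 := fun t => by
      have : (ρ.tuple s : M₃) + t • ((a / 3) • (ρ.tuple s : M₃)) =
          (1 + t * (a / 3)) • (ρ.tuple s : M₃) := by
        rw [add_smul, one_smul, smul_smul]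
      rw [this, det_smul, Matrix.SpecialLinearGroup.det_coe, mul_one, Fintype.card_fin]
    simp only [h1]
    convert! ((hasDerivAt_affine 1 (a / 3)).pow 3).sub_const 1 using 1
    norm_num
    ring
  refine ⟨_, fderiv_deriv_eq hx (contDiff_localEq.differentiable (by simp) _) hd
    (HasDerivAt.prodMk ?_ (HasDerivAt.prodMk ?_ ?_))⟩
  · rw [hasDerivAt_pi]
    rintro (i | i | j)
    · exact hscal (Gen.a i) _ 0
    · exact hscal (Gen.b i) _ 0
    · change HasDerivAt (fun t => (Matrix.of (c t (Gen.c j))).det - 1) _ 0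
      simp only [hcj, det_conj, det_jordanBlock_add]
      exact (hasDerivAt_affine 1 _).sub_const 1
  · rw [hasDerivAt_pi]
    intro j
    simp only [hcj, trace_conj, trace_jordanBlock_add]
    exact (hasDerivAt_affine 3 _).sub_const 3
  · rw [hasDerivAt_pi]
    intro j
    simp only [hcj, adjugate_conj, trace_conj, trace_adjugate_jordanBlock_add]
    exact (hasDerivAt_affine 3 _).sub_const 3

end LocalEquations

/-! ### Dimension count and straightening of the slice equations -/

section LevelSet

/-- The target of the equations of a slice. -/
abbrev EqTarget (g p : ℕ) : Type :=
  ((Gen g p → ℝ) × (Fin p → ℝ) × (Fin p → ℝ)) × (Fin 8 → ℝ) × (Fin 8 → ℝ)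

/-- There are `2g + p` determinants, `2p` traces, and 8 equations each for relator and frame. -/
theorem finrank_eqTarget : Module.finrank ℝ (EqTarget g p) = 2 * g + 3 * p + 16 := by
  simp only [EqTarget, Module.finrank_prod, Module.finrank_fintype_fun_eq_card, Fintype.card_sum,
    Fintype.card_fin]
  ring

theorem finrank_matTuples : Module.finrank ℝ (MatTuples g p) = 9 * (2 * g + p) := by
  simp only [MatTuples, Module.finrank_pi_fintype,
    Fintype.card_fin, Finset.sum_const, Finset.card_univ, Fintype.card_sum, smul_eq_mul,
    Module.finrank_self]
  ring

/-- The equations of a slice. -/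
def sliceEq (j : Fin p) (w : Fin 3 → List (Gen g p × Bool)) (e : Fin 3 → ℝ) (C : M₃)
    (x : MatTuples g p) : EqTarget g p :=
  (localEq x, modScalar (relatorVal x), modScalar (frame j w e C x))

theorem contDiff_sliceEq (j : Fin p) (w : Fin 3 → List (Gen g p × Bool)) (e : Fin 3 → ℝ)
    (C : M₃) : ContDiff ℝ ∞ (sliceEq j w e C) :=
  contDiff_localEq.prodMk (contDiff_modScalar_relatorVal.prodMk (contDiff_modScalar_frame j w e C))

/-- The system is block triangular: `u2` corrects the relator without moving the local equations,
and `u3` corrects the frame without moving either. -/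
theorem surjective_fderiv_sliceEq (ρ : HomPIrr g p) {j : Fin p}
    {w : Fin 3 → List (Gen g p × Bool)} {e : Fin 3 → ℝ} {C : M₃}
    (hframe : frame j w e C (entries ρ) = 1) :
    Function.Surjective (fderiv ℝ (sliceEq j w e C) (entries ρ)) := by
  have h1 := (contDiff_localEq.differentiable (by simp) (entries ρ)).hasFDerivAt
  have h2 := (contDiff_modScalar_relatorVal.differentiable (by simp) (entries ρ)).hasFDerivAt
  have h3 := ((contDiff_modScalar_frame j w e C).differentiable (by simp)
    (entries ρ)).hasFDerivAt
  have h := (h1.prodMk (h2.prodMk h3)).fderiv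
  change fderiv ℝ (sliceEq j w e C) (entries ρ) = _ at h
  rw [h]
  rintro ⟨z1, z2, z3⟩
  obtain ⟨u1, hu1⟩ := exists_fderiv_localEq_eq ρ z1
  obtain ⟨u2, hu2, hu2'⟩ := exists_fderiv_relatorVal_eq (Fin.pos j) ρ (z2 -
    fderiv ℝ (fun x : MatTuples g p => modScalar (relatorVal x)) (entries ρ) u1)
  obtain ⟨u3, hu3, hu3', hu3''⟩ := exists_fderiv_frame_eq ρ hframe (z3 -
    fderiv ℝ (fun x : MatTuples g p => modScalar (frame j w e C x)) (entries ρ) (u1 + u2))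
  refine ⟨u1 + u2 + u3, ?_⟩
  simp only [ContinuousLinearMap.prod_apply]
  refine Prod.ext ?_ (Prod.ext ?_ ?_)
  · simp only [map_add, hu1, hu2, hu3, add_zero]
  · simp only [map_add, hu2', hu3', add_zero]
    abel
  · simp only [map_add, hu3'']
    abel

/-- A smooth map with surjective derivative at a point is, near that point, the first component of
a local diffeomorphism. -/
theorem exists_straightening {E T W : Type*} [NormedAddCommGroup E] [NormedSpace ℝ E]
    [FiniteDimensional ℝ E] [NormedAddCommGroup T] [NormedSpace ℝ T] [FiniteDimensional ℝ T]
    [NormedAddCommGroup W] [NormedSpace ℝ W] [FiniteDimensional ℝ W] {G : E → T} {x : E}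
    (hG : ContDiff ℝ ∞ G) (hsurj : Function.Surjective (fderiv ℝ G x))
    (hdim : Module.finrank ℝ E = Module.finrank ℝ T + Module.finrank ℝ W) :
    ∃ (ψ : E →L[ℝ] W) (Φ : OpenPartialHomeomorph E (T × W)), x ∈ Φ.source ∧
      (∀ y, Φ y = (G y, ψ y)) ∧ ContDiffOn ℝ ∞ Φ.symm Φ.target := by
  set L := fderiv ℝ G x with hL
  have hker : Module.finrank ℝ (LinearMap.ker L.toLinearMap) = Module.finrank ℝ W := by
    have h := LinearMap.finrank_range_add_finrank_ker L.toLinearMap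
    rw [LinearMap.range_eq_top.2 hsurj, finrank_top] at h
    omega
  obtain ⟨q, hq⟩ := (LinearMap.ker L.toLinearMap).exists_isCompl
  let κ := LinearEquiv.ofFinrankEq _ _ hker
  let ψ₀ : E →ₗ[ℝ] W := κ.toLinearMap ∘ₗ
    (LinearMap.ker L.toLinearMap).projectionOnto q hq
  let ψ : E →L[ℝ] W := ψ₀.toContinuousLinearMap
  -- The map `ψ` is a projection onto the kernel of `L`, identified with `W` by dimension, so
  -- nothing is killed by both.
  have hinj : Function.Injective (L.prod ψ) := by
    rw [injective_iff_map_eq_zero]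
    intro u hu
    have h1 : L u = 0 := congrArg Prod.fst hu
    have h2 : ψ₀ u = 0 := congrArg Prod.snd hu
    have h3 := κ.map_eq_zero_iff.1 h2
    have h4 := Submodule.projectionOnto_apply_left hq ⟨u, h1⟩
    rw [h3] at h4
    exact (congrArg Subtype.val h4).symm
  have hfin : Module.finrank ℝ E = Module.finrank ℝ (T × W) := by
    rw [Module.finrank_prod, hdim]
  let Lequiv : E ≃L[ℝ] T × W :=
    (LinearEquiv.ofInjectiveOfFinrankEq (L.prod ψ).toLinearMap hinj hfin).toContinuousLinearEquiv
  have hLe : (Lequiv : E →L[ℝ] T × W) = L.prod ψ := by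
    ext1 u; rfl
  let F : E → T × W := fun y => (G y, ψ y)
  have hF : ContDiff ℝ ∞ F := hG.prodMk ψ.contDiff
  have hF' : HasFDerivAt F (Lequiv : E →L[ℝ] T × W) x := by
    rw [hLe]
    exact ((hG.differentiable (by simp) x).hasFDerivAt).prodMk ψ.hasFDerivAt
  let Φ₀ := hF.contDiffAt.toOpenPartialHomeomorph F hF' (by simp)
  -- Restricting to the open set where the derivative is invertible makes the inverse smooth on the
  -- whole target and not just at one point.
  let D : Set E := fderiv ℝ F ⁻¹' Set.range ((↑) : (E ≃L[ℝ] T × W) → E →L[ℝ] T × W)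
  have hD : IsOpen D := ContinuousLinearEquiv.isOpen.preimage (hF.continuous_fderiv (by simp))
  have hxD : x ∈ D := ⟨Lequiv, hF'.fderiv.symm⟩
  refine ⟨ψ, Φ₀.restrOpen D hD, ⟨hF.contDiffAt.mem_toOpenPartialHomeomorph_source hF' (by simp),
    hxD⟩, fun y => rfl, fun z hz => ?_⟩
  have hz' := (Φ₀.restrOpen D hD).map_target hz
  obtain ⟨A, hA⟩ : (Φ₀.restrOpen D hD).symm z ∈ D := hz'.2
  refine (OpenPartialHomeomorph.contDiffAt_symm (f₀' := A) _ hz ?_ hF.contDiffAt).contDiffWithinAt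
  rw [hA]
  exact (hF.differentiable (by simp) _).hasFDerivAt

end LevelSet

/-! ### Topology of the quotient: open projection, Hausdorff, second countable -/

section Topology

theorem isInducing_entries : Topology.IsInducing (entries : HomPIrr g p → MatTuples g p) := by
  have h1 : Topology.IsInducing fun (ρ : HomPIrr g p) (s : Gen g p) => ρ.1 (gen s) := ⟨rfl⟩
  have h2 : Topology.IsInducing fun (X : Gen g p → SL(3, ℝ)) (s : Gen g p) => (X s : M₃) :=
    Topology.IsInducing.piMap fun _ => Topology.IsInducing.subtypeVal
  exact h2.comp h1

/-- Conjugation of all matrices of a tuple. -/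
def conjTuple (h : SL(3, ℝ)) (x : MatTuples g p) : MatTuples g p :=
  fun s i j => ((h : M₃) * Matrix.of (x s) * adjugate (h : M₃)) i j

theorem contDiff_conjTuple (h : SL(3, ℝ)) :
    ContDiff ℝ ∞ (conjTuple h : MatTuples g p → MatTuples g p) := by
  refine contDiff_pi.2 fun s => contDiff_pi.2 fun i => contDiff_pi.2 fun j => ?_
  exact contDiffOn_univ.1 ((((smoothEntriesOn_const _).mul (smoothEntriesOn_coord s _)).mul
    (smoothEntriesOn_const _)) i j)

theorem entries_conj (h : SL(3, ℝ)) (ρ : HomPIrr g p) :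
    entries (ρ.conj h) = conjTuple h (entries ρ) := by
  funext s i j
  exact congrFun (congrFun (HomPIrr.of_entries_conj h ρ s) i) j

theorem continuous_conj (h : SL(3, ℝ)) :
    Continuous (HomPIrr.conj h : HomPIrr g p → HomPIrr g p) := by
  rw [isInducing_entries.continuous_iff]
  have : entries ∘ (HomPIrr.conj h : HomPIrr g p → HomPIrr g p) = conjTuple h ∘ entries :=
    funext fun ρ => entries_conj h ρ
  rw [this]
  exact (contDiff_conjTuple h).continuous.comp isInducing_entries.continuous

theorem isOpenQuotientMap_proj : IsOpenQuotientMap (proj : HomPIrr g p → RepPIrr g p) := by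
  have hq : Topology.IsQuotientMap (proj : HomPIrr g p → RepPIrr g p) := isQuotientMap_quot_mk
  refine IsOpenQuotientMap.of_isOpenMap_isQuotientMap (fun U hU => ?_) hq
  rw [← hq.isOpen_preimage]
  have : proj ⁻¹' (proj '' U) = ⋃ h : SL(3, ℝ), HomPIrr.conj h ⁻¹' U := by
    ext ρ
    simp only [Set.mem_preimage, Set.mem_image, Set.mem_iUnion]
    constructor
    · rintro ⟨ρ', hρ', heq⟩
      obtain ⟨h, rfl⟩ := HomPIrr.proj_eq_iff.1 heq.symm
      exact ⟨h, hρ'⟩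
    · rintro ⟨h, hh⟩
      exact ⟨_, hh, HomPIrr.proj_conj h ρ⟩
  rw [this]
  exact isOpen_iUnion fun h => hU.preimage (continuous_conj h)

theorem exists_symmetry (ρ ρ' : HomPIrr g p) (h : proj ρ = proj ρ') :
    ∃ (a : HomPIrr g p → HomPIrr g p) (A : MatTuples g p → MatTuples g p), ContDiff ℝ ∞ A ∧
      (∀ τ, entries (a τ) = A (entries τ)) ∧ (∀ τ, proj (a τ) = proj τ) ∧ a ρ = ρ' := by
  obtain ⟨k, rfl⟩ := HomPIrr.proj_eq_iff.1 h
  exact ⟨_, _, contDiff_conjTuple k, entries_conj k, HomPIrr.proj_conj k, rfl⟩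

theorem intertwines_of_tuple {ρ ρ' : HomPIrr g p} {T : M₃}
    (hT : ∀ s, T * (ρ.tuple s : M₃) = ρ'.tuple s * T) (γ : Pi1 g p) :
    T * (ρ.1 γ : M₃) = ρ'.1 γ * T := by
  let S : Subgroup (Pi1 g p) :=
    { carrier := {γ | T * (ρ.1 γ : M₃) = ρ'.1 γ * T}
      one_mem' := by simp
      mul_mem' := fun {γ δ} h k => by
        simp only [Set.mem_ofPred_eq, map_mul, Matrix.SpecialLinearGroup.coe_mul] at *
        rw [← mul_assoc, h, mul_assoc, k, mul_assoc]
      inv_mem' := fun {γ} h => by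
        simp only [Set.mem_ofPred_eq, map_inv, Matrix.SpecialLinearGroup.coe_inv] at *
        have h1 := congrArg (fun M => adjugate (ρ'.1 γ : M₃) * M * adjugate (ρ.1 γ : M₃)) h
        simp only [mul_assoc, coe_mul_adjugate, mul_one] at h1
        simp only [← mul_assoc, adjugate_mul_coe, one_mul] at h1
        exact h1.symm }
  have h1 : (⊤ : Subgroup (Pi1 g p)) ≤ S := by
    rw [← PresentedGroup.closure_range_of, Subgroup.closure_le]
    rintro _ ⟨s, rfl⟩
    exact hT s
  exact h1 (Subgroup.mem_top γ)

/-- The kernel of `T` is invariant, so irreducibility makes `T` invertible, and it can be rescaled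
into `SL(3, ℝ)`. -/
theorem proj_eq_of_intertwines {ρ ρ' : HomPIrr g p} {T : M₃} (hT0 : T ≠ 0)
    (hT : ∀ s, T * (ρ.tuple s : M₃) = ρ'.tuple s * T) : proj ρ = proj ρ' := by
  have hT' := intertwines_of_tuple hT
  have hdet : T.det ≠ 0 := by
    intro h0
    obtain ⟨u, hu0, hu⟩ := Matrix.exists_mulVec_eq_zero_iff.2 h0
    have hle : Submodule.span ℝ (Set.range fun γ => (ρ.1 γ : M₃) *ᵥ u) ≤
        LinearMap.ker (Matrix.toLin' T) := by
      rw [Submodule.span_le]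
      rintro _ ⟨γ, rfl⟩
      simp only [SetLike.mem_coe, LinearMap.mem_ker, toLin'_apply]
      rw [mulVec_mulVec, hT', ← mulVec_mulVec, hu, mulVec_zero]
    rw [span_orbit_eq_top ρ.2.1 hu0, top_le_iff, LinearMap.ker_eq_top] at hle
    exact hT0 (Matrix.toLin'.map_eq_zero_iff.1 hle)
  obtain ⟨h, hh⟩ := exists_conj_of_intertwines hdet
  exact HomPIrr.proj_eq_iff.2 ⟨h, Subtype.ext (MonoidHom.ext fun γ => hh _ _ (hT' γ))⟩

/-- It suffices that the orbit relation is closed. It consists of the pairs with an intertwiner of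
norm one, so it is the image of a closed set under projection along a compact sphere. -/
theorem t2Space_repPIrr : T2Space (RepPIrr g p) := by
  rw [t2Space_iff_of_isOpenQuotientMap isOpenQuotientMap_proj]
  let Z : Set (Metric.sphere (0 : Fin 3 → Fin 3 → ℝ) 1 × (HomPIrr g p × HomPIrr g p)) :=
    {z | ∀ s i j, ((Matrix.of z.1.1 : M₃) * Matrix.of (entries z.2.1 s)) i j =
      ((Matrix.of (entries z.2.2 s) : M₃) * Matrix.of z.1.1) i j}
  have hent : Continuous (entries : HomPIrr g p → MatTuples g p) := isInducing_entries.continuous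
  have h1 : ∀ s i j, Continuous fun z : Metric.sphere (0 : Fin 3 → Fin 3 → ℝ) 1 ×
      (HomPIrr g p × HomPIrr g p) => entries z.2.1 s i j := fun s i j =>
    (continuous_apply_apply i j).comp
      ((continuous_apply s).comp (hent.comp (continuous_fst.comp continuous_snd)))
  have h2 : ∀ s i j, Continuous fun z : Metric.sphere (0 : Fin 3 → Fin 3 → ℝ) 1 ×
      (HomPIrr g p × HomPIrr g p) => entries z.2.2 s i j := fun s i j =>
    (continuous_apply_apply i j).comp
      ((continuous_apply s).comp (hent.comp (continuous_snd.comp continuous_snd)))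
  have h3 : ∀ i j, Continuous fun z : Metric.sphere (0 : Fin 3 → Fin 3 → ℝ) 1 ×
      (HomPIrr g p × HomPIrr g p) => z.1.1 i j := fun i j =>
    (continuous_apply_apply i j).comp (continuous_subtype_val.comp continuous_fst)
  have hZ : IsClosed Z := by
    simp only [Z, Set.ofPred_forall]
    refine isClosed_iInter fun s => isClosed_iInter fun i => isClosed_iInter fun j => ?_
    simp only [mul_apply, of_apply]
    exact isClosed_eq (continuous_finsetSum _ fun k _ => (h3 i k).mul (h1 s k j))
      (continuous_finsetSum _ fun k _ => (h2 s i k).mul (h3 k j))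
  convert! isClosedMap_snd_of_compactSpace _ hZ using 1
  ext ⟨ρ, ρ'⟩
  constructor
  · intro h
    obtain ⟨k, rfl⟩ := HomPIrr.proj_eq_iff.1 (show proj ρ = proj ρ' from h)
    let T : Fin 3 → Fin 3 → ℝ := fun i j => (k : M₃) i j
    have hT0 : T ≠ 0 := fun h0 => by
      have h4 : (k : M₃) = 0 := Matrix.ext fun i j => congrFun (congrFun h0 i) j
      have h5 := k.2
      rw [h4, det_zero] at h5
      exact zero_ne_one h5
    refine ⟨(⟨‖T‖⁻¹ • T, ?_⟩, (ρ, ρ.conj k)), ?_, rfl⟩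
    · rw [mem_sphere_zero_iff_norm, norm_smul, norm_inv, norm_norm,
        inv_mul_cancel₀ (norm_ne_zero_iff.2 hT0)]
    · intro s i j
      have h4 : (Matrix.of (‖T‖⁻¹ • T) : M₃) = ‖T‖⁻¹ • (k : M₃) := rfl
      simp only [h4]
      rw [HomPIrr.of_entries_conj, HomPIrr.of_entries, smul_mul_assoc, mul_smul_comm, mul_assoc,
        adjugate_mul_coe, mul_one]
  · rintro ⟨⟨⟨T, hT1⟩, τ⟩, hz, rfl⟩
    refine proj_eq_of_intertwines (T := Matrix.of T) (fun h0 => ?_) fun s =>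
      Matrix.ext fun i j => hz s i j
    have h4 : T = 0 := h0
    rw [h4] at hT1
    simp at hT1

theorem secondCountableTopology_repPIrr : SecondCountableTopology (RepPIrr g p) := by
  have h1 : SecondCountableTopology (HomPIrr g p) := isInducing_entries.secondCountableTopology
  exact isOpenQuotientMap_proj.isQuotientMap.secondCountableTopology
    isOpenQuotientMap_proj.isOpenMap

end Topology

/-! ### Normal forms and construction of the slices -/

section Slice

variable (j : Fin p) (w : Fin 3 → List (Gen g p × Bool)) (e : Fin 3 → ℝ) (C : M₃)

/-- The conjugate of a tuple of matrices by the inverse of its frame. -/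
def normalForm (x : MatTuples g p) : MatTuples g p := fun s i k =>
  (frame j w e C x).det⁻¹ *
    (adjugate (frame j w e C x) * Matrix.of (x s) * frame j w e C x) i k

/-- The tuples with an invertible frame and regular matrices at the punctures. -/
def frameDomain : Set (MatTuples g p) :=
  {x | (frame j w e C x).det ≠ 0 ∧ ∀ k : Fin p, (Matrix.of (x (Gen.c k)) - 1 : M₃) ^ 2 ≠ 0}

theorem isOpen_frameDomain : IsOpen (frameDomain j w e C) := by
  have h1 : Continuous fun x : MatTuples g p => (frame j w e C x).det :=
    (contDiffOn_univ.1 (smoothEntriesOn_frame j w e C Set.univ).det).continuous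
  refine (isOpen_ne.preimage h1).inter ?_
  change IsOpen {x : MatTuples g p | ∀ k : Fin p, (Matrix.of (x (Gen.c k)) - 1 : M₃) ^ 2 ≠ 0}
  simp only [Set.ofPred_forall]
  refine isOpen_iInter_of_finite fun k => ?_
  have h2 : Continuous fun x : MatTuples g p => (Matrix.of (x (Gen.c k)) - 1 : M₃) ^ 2 := by
    refine continuous_matrix fun a b => ?_
    have h := (smoothEntriesOn_coord (Gen.c k : Gen g p) Set.univ).sub (smoothEntriesOn_const 1)
    simp only [pow_two]
    exact (contDiffOn_univ.1 ((h.mul h) a b)).continuous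
  exact isOpen_ne.preimage h2

theorem contDiffOn_normalForm : ContDiffOn ℝ ∞ (normalForm j w e C) (frameDomain j w e C) := by
  have hK := smoothEntriesOn_frame j w e C (frameDomain j w e C)
  refine contDiffOn_pi.2 fun s => contDiffOn_pi.2 fun i => contDiffOn_pi.2 fun k => ?_
  exact (hK.det.inv fun x hx => hx.1).mul
    (((hK.adjugate.mul (smoothEntriesOn_coord s _)).mul hK) i k)

variable {j w e C}

theorem normalForm_entries {ρ : HomPIrr g p} {c : ℝ} (hc : c ≠ 0) {h : SL(3, ℝ)}
    (hK : frame j w e C (entries ρ) = c • (h : M₃)) :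
    normalForm j w e C (entries ρ) = entries (ρ.conj h⁻¹) := by
  funext s i k
  have h1 : adjugate ((h⁻¹ : SL(3, ℝ)) : M₃) = h := by
    rw [← Matrix.SpecialLinearGroup.coe_inv, inv_inv]
  have h2 := congrFun (congrFun (HomPIrr.of_entries_conj h⁻¹ ρ s) i) k
  rw [h1, Matrix.SpecialLinearGroup.coe_inv] at h2
  change _ = Matrix.of (entries (ρ.conj h⁻¹) s) i k
  rw [h2, normalForm, hK, det_smul, adjugate_smul, Matrix.SpecialLinearGroup.det_coe, mul_one,
    Fintype.card_fin, smul_mul_assoc, smul_mul_assoc, mul_smul_comm, smul_smul, Matrix.smul_apply,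
    smul_eq_mul, ← mul_assoc, ← pow_succ, HomPIrr.of_entries]
  rw [show 3 - 1 + 1 = 3 from rfl, inv_mul_cancel₀ (pow_ne_zero 3 hc), one_mul]

theorem normalForm_eq_self {x : MatTuples g p} (h0 : (frame j w e C x).det ≠ 0)
    (hK : modScalar (frame j w e C x) = 0) : normalForm j w e C x = x := by
  have hK' := eq_smul_one_of_modScalar hK
  set m := frame j w e C x 0 0
  rw [hK', det_smul, det_one, mul_one, Fintype.card_fin] at h0
  funext s i k
  rw [normalForm, hK', det_smul, adjugate_smul, adjugate_one, det_one, mul_one, Fintype.card_fin,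
    smul_mul_assoc, one_mul, mul_smul_comm, mul_one, smul_smul, Matrix.smul_apply, smul_eq_mul,
    ← mul_assoc, ← pow_succ', show 3 - 1 + 1 = 3 from rfl, inv_mul_cancel₀ h0, one_mul]
  rfl

/-- By equivariance, conjugating by the inverse of the frame makes the frame scalar, so the orbit
meets the slice. -/
theorem exists_normalForm_eq {ρ : HomPIrr g p} (h0 : (frame j w e C (entries ρ)).det ≠ 0) :
    ∃ τ : HomPIrr g p, normalForm j w e C (entries ρ) = entries τ ∧ proj τ = proj ρ ∧
      sliceEq j w e C (entries τ) = 0 := by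
  obtain ⟨c, h, hc, hK⟩ := exists_smul_coe_eq h0
  refine ⟨_, normalForm_entries hc hK, HomPIrr.proj_conj _ _, ?_⟩
  obtain ⟨μ, hμ⟩ := exists_frame_conj j w e C (fixedVec_ne_zero_of_det h0) h⁻¹
  refine Prod.ext ?_ (Prod.ext ?_ ?_)
  · exact localEq_slEntries fun k => (ρ.conj h⁻¹).isParabolic_tuple k
  · change modScalar (relatorVal _) = 0
    rw [HomPIrr.relatorVal_entries, modScalar_one]
  · change modScalar (frame j w e C _) = 0
    rw [hμ, hK, mul_smul_comm, ← Matrix.SpecialLinearGroup.coe_mul, inv_mul_cancel, smul_smul,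
      Matrix.SpecialLinearGroup.coe_one, modScalar_smul_one]

/-- If `h` is the rescaled frame of `ρ`, then `k h` is one for its conjugate by `k`, and the two
occurrences of `k` cancel. -/
theorem normalForm_eq_of_proj_eq {ρ ρ' : HomPIrr g p}
    (h0 : (frame j w e C (entries ρ)).det ≠ 0) (h0' : (frame j w e C (entries ρ')).det ≠ 0)
    (h : proj ρ = proj ρ') :
    normalForm j w e C (entries ρ) = normalForm j w e C (entries ρ') := by
  obtain ⟨k, rfl⟩ := HomPIrr.proj_eq_iff.1 h
  obtain ⟨c, h, hc, hK⟩ := exists_smul_coe_eq h0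
  obtain ⟨μ, hμ⟩ := exists_frame_conj j w e C (fixedVec_ne_zero_of_det h0) k
  rw [hK, mul_smul_comm, smul_smul, ← Matrix.SpecialLinearGroup.coe_mul] at hμ
  have hμc : μ * c ≠ 0 := by
    intro h1
    rw [hμ, h1, zero_smul, det_zero] at h0'
    exact h0' rfl
  rw [normalForm_entries hc hK, normalForm_entries hμc hμ]
  congr 1
  refine HomPIrr.ext_tuple fun s => ?_
  simp only [HomPIrr.tuple, HomPIrr.conj_apply]
  group

/-- The solutions of the slice equations, in the domain of the frame, are irreducible parabolic
representations. -/
theorem exists_entries_eq {x : MatTuples g p} (hx : x ∈ frameDomain j w e C)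
    (h0 : sliceEq j w e C x = 0) : ∃ ρ : HomPIrr g p, entries ρ = x := by
  have hloc : localEq x = 0 := congrArg Prod.fst h0
  have hrel : modScalar (relatorVal x) = 0 := congrArg (fun z => z.2.1) h0
  have hdet : ∀ s, (Matrix.of (x s) : M₃).det = 1 := fun s =>
    sub_eq_zero.1 (congrFun (congrArg Prod.fst hloc) s)
  have htr : ∀ k : Fin p, (Matrix.of (x (Gen.c k)) : M₃).trace = 3 := fun k =>
    sub_eq_zero.1 (congrFun (congrArg (fun z => z.2.1) hloc) k)
  have htr' : ∀ k : Fin p, (adjugate (Matrix.of (x (Gen.c k)) : M₃)).trace = 3 := fun k =>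
    sub_eq_zero.1 (congrFun (congrArg (fun z => z.2.2) hloc) k)
  let X : Gen g p → SL(3, ℝ) := fun s => ⟨Matrix.of (x s), hdet s⟩
  have hxX : slEntries X = x := rfl
  have hX : FreeGroup.lift X (relator g p) = 1 := by
    rw [← hxX, relatorVal_slEntries] at hrel
    exact Subtype.ext (eq_one_of_modScalar hrel (Matrix.SpecialLinearGroup.det_coe _))
  have hpar : ∀ k, IsParabolic (X (Gen.c k)) := fun k =>
    isParabolic_of_sub_one_pow (sub_one_pow_three_eq_zero (hdet _) (htr k) (htr' k)) (hx.2 k)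
  have hgen := HomPIrr.ofTuple_gen X hX
  have hword : ∀ L, wordVal x L =
      (HomPIrr.ofTuple X hX (PresentedGroup.mk _ (FreeGroup.mk L)) : M₃) := by
    intro L
    rw [← hxX, wordVal_slEntries]
    rfl
  have hc : IsParabolic (HomPIrr.ofTuple X hX (gen (Gen.c j))) := by
    rw [hgen]; exact hpar j
  have hirr : (linearRep (HomPIrr.ofTuple X hX)).IsIrreducible := by
    -- Irreducibility comes for free: an invertible frame means that three translates of the fixed
    -- vector already span.
    refine isIrreducible_of_span (v := fixedVec j e x) hc ?_ ?_
    · have h1 := hc.sub_one_mulVec e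
      rw [hgen] at h1 ⊢
      exact h1
    · intro u _
      have h2 := hx.1
      rw [frame, det_mul] at h2
      set M : M₃ := Matrix.of fun i k => (wordVal x (w k) *ᵥ fixedVec j e x) i with hM
      have h3 : IsUnit M.det := isUnit_iff_ne_zero.2 (left_ne_zero_of_mul h2)
      have h4 : u = ∑ k, (M⁻¹ *ᵥ u) k • (wordVal x (w k) *ᵥ fixedVec j e x) := by
        have h5 : u = M *ᵥ (M⁻¹ *ᵥ u) := by
          rw [mulVec_mulVec, Matrix.mul_nonsing_inv _ h3, one_mulVec]
        conv_lhs => rw [h5]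
        ext i
        rw [mulVec, dotProduct, Finset.sum_apply]
        refine Finset.sum_congr rfl fun k _ => ?_
        rw [Pi.smul_apply, smul_eq_mul, mul_comm]
        rfl
      rw [h4]
      refine Submodule.sum_mem _ fun k _ => Submodule.smul_mem _ _ (Submodule.subset_span ?_)
      exact ⟨_, by rw [hword]⟩
  exact ⟨⟨HomPIrr.ofTuple X hX, hirr, fun k => by rw [hgen]; exact hpar k⟩, by
    funext s a b
    change (HomPIrr.ofTuple X hX (gen s) : M₃) a b = _
    rw [hgen]
    rfl⟩

theorem mem_frameDomain {ρ : HomPIrr g p} (h0 : (frame j w e C (entries ρ)).det ≠ 0) :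
    entries ρ ∈ frameDomain j w e C :=
  ⟨h0, fun k => (ρ.isParabolic_tuple k).sub_one_pow_two_ne_zero⟩

/-- A surjective derivative cannot have more equations than variables: `2g + 3p + 16 ≤ 9(2g + p)`.
-/
theorem le_of_homPIrr (hp : 0 < p) (ρ : HomPIrr g p) : 16 ≤ 16 * g + 6 * p := by
  obtain ⟨w, e, C, hframe⟩ := exists_frame_eq_one ⟨0, hp⟩ ρ
  have h := LinearMap.finrank_le_finrank_of_surjective
    (f := (fderiv ℝ (sliceEq ⟨0, hp⟩ w e C) (entries ρ)).toLinearMap)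
    (surjective_fderiv_sliceEq ρ hframe)
  rw [finrank_eqTarget, finrank_matTuples] at h
  omega

theorem nonempty_localSlice (hp : 0 < p) (ρ : HomPIrr g p) :
    Nonempty (LocalSlice (entries : HomPIrr g p → MatTuples g p) proj
      (EuclideanSpace ℝ (Fin (16 * g + 6 * p - 16))) ρ) := by
  classical
  obtain ⟨w, e, C, hframe⟩ := exists_frame_eq_one ⟨0, hp⟩ ρ
  set j : Fin p := ⟨0, hp⟩
  obtain ⟨ψ, Φ, hxΦ, hΦ, hΦs⟩ := exists_straightening
    (W := EuclideanSpace ℝ (Fin (16 * g + 6 * p - 16))) (contDiff_sliceEq j w e C)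
    (surjective_fderiv_sliceEq ρ hframe) (by
      -- Guarantees that the truncated subtraction in the dimension is a genuine one.
      have := le_of_homPIrr hp ρ
      rw [finrank_eqTarget, finrank_matTuples, finrank_euclideanSpace_fin]
      omega)
  set D := frameDomain j w e C with hD
  set r := normalForm j w e C with hr
  have hDo : IsOpen D := isOpen_frameDomain j w e C
  have hrD : ContDiffOn ℝ ∞ r D := contDiffOn_normalForm j w e C
  -- The normal form may leave `D`, since the scale of its frame can vanish; this is excluded here,
  -- along with leaving the source of `Φ`.
  let U : Set (MatTuples g p) := D ∩ r ⁻¹' (D ∩ Φ.source)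
  have hU : IsOpen U := hrD.continuousOn.isOpen_inter_preimage hDo (hDo.inter Φ.open_source)
  let ι₀ : EuclideanSpace ℝ (Fin (16 * g + 6 * p - 16)) → EqTarget g p ×
    EuclideanSpace ℝ (Fin (16 * g + 6 * p - 16)) := fun v => (0, v)
  have hι₀ : ContDiff ℝ ∞ ι₀ := contDiff_const.prodMk contDiff_id
  let V : Set (EuclideanSpace ℝ (Fin (16 * g + 6 * p - 16))) :=
    ι₀ ⁻¹' (Φ.target ∩ Φ.symm ⁻¹' U)
  have hV : IsOpen V :=
    (Φ.symm.continuousOn.isOpen_inter_preimage Φ.open_target hU).preimage hι₀.continuous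
  -- On `V` the point `Φ.symm (0, v)` solves the slice equations and so comes from a representation;
  -- the default `ρ` is not reached there.
  let s : EuclideanSpace ℝ (Fin (16 * g + 6 * p - 16)) → HomPIrr g p := fun v =>
    if h : ∃ τ : HomPIrr g p, entries τ = Φ.symm (0, v) then h.choose else ρ
  have hself : ∀ y ∈ D, sliceEq j w e C y = 0 → r y = y := fun y hy h0 =>
    normalForm_eq_self hy.1 (congrArg (fun z => z.2.2) h0)
  have heqV : ∀ v ∈ V, sliceEq j w e C (Φ.symm (0, v)) = 0 ∧ ψ (Φ.symm (0, v)) = v := fun v hv => by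
    have h1 := Φ.right_inv hv.1
    rw [hΦ] at h1
    exact ⟨congrArg Prod.fst h1, congrArg Prod.snd h1⟩
  have hs : ∀ v ∈ V, entries (s v) = Φ.symm (0, v) := fun v hv => by
    have h : ∃ τ : HomPIrr g p, entries τ = Φ.symm (0, v) :=
      exists_entries_eq hv.2.1 (heqV v hv).1
    simp only [s, dif_pos h]
    exact h.choose_spec
  have hF : ∀ τ : HomPIrr g p, entries τ ∈ U → ψ (r (entries τ)) ∈ V ∧
      Φ.symm (0, ψ (r (entries τ))) = r (entries τ) := fun τ hτ => by
    obtain ⟨σ, hσ, -, hσ0⟩ := exists_normalForm_eq hτ.1.1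
    have h1 : Φ (r (entries τ)) = (0, ψ (r (entries τ))) := by
      rw [hΦ, hr, hσ, hσ0]
    have h2 : Φ.symm (0, ψ (r (entries τ))) = r (entries τ) := by
      rw [← h1, Φ.left_inv hτ.2.2]
    have h3 : r (r (entries τ)) = r (entries τ) := hself _ hτ.2.1 (by rw [hr, hσ, hσ0])
    refine ⟨⟨?_, ?_⟩, h2⟩
    · change (0, ψ (r (entries τ))) ∈ Φ.target
      rw [← h1]
      exact Φ.map_source hτ.2.2
    · change Φ.symm (0, ψ (r (entries τ))) ∈ U
      rw [h2]
      refine ⟨hτ.2.1, ?_⟩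
      rw [Set.mem_preimage, h3]
      exact hτ.2
  have hρD : entries ρ ∈ D := mem_frameDomain (by rw [hframe, det_one]; exact one_ne_zero)
  have hρr : r (entries ρ) = entries ρ :=
    normalForm_eq_self hρD.1 (by rw [hframe, modScalar_one])
  have hρU : entries ρ ∈ U := ⟨hρD, by rw [Set.mem_preimage, hρr]; exact ⟨hρD, hxΦ⟩⟩
  exact ⟨{
    U := U
    V := V
    F := fun x => ψ (r x)
    s := s
    isOpen_U := hU
    isOpen_V := hV
    mem_U := hρU
    contDiffOn_F := ψ.contDiff.comp_contDiffOn (hrD.mono Set.inter_subset_left)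
    contDiffOn_s := (hΦs.comp hι₀.contDiffOn fun v (hv : v ∈ V) => hv.1).congr hs
    F_mem := fun τ hτ => (hF τ hτ).1
    π_s := fun τ hτ => by
      obtain ⟨σ, hσ, hσp, -⟩ := exists_normalForm_eq hτ.1.1
      have h1 := hs _ (hF τ hτ).1
      rw [(hF τ hτ).2, hr, hσ] at h1
      rw [← hσp, ← HomPIrr.entries_injective h1, hr, hσ]
    s_mem := fun v hv => by
      rw [hs v hv]
      exact hv.2
    F_s := fun v hv => by
      rw [hs v hv, hself _ hv.2.1 (heqV v hv).1, (heqV v hv).2]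
    F_inv := fun τ σ hτ hσ h => congrArg ψ (normalForm_eq_of_proj_eq hτ.1.1 hσ.1.1 h)
    s_base := HomPIrr.entries_injective (by rw [hs _ (hF ρ hρU).1, (hF ρ hρU).2, hρr]) }⟩

end Slice

end PuncturedSurface

end

theorem mainTheorem10 (g p : ℕ) (hp : 1 ≤ p) :
    (16 * g + 6 * p < 16 → IsEmpty (PuncturedSurface.RepPIrr g p)) ∧
    T2Space (PuncturedSurface.RepPIrr g p) ∧
    SecondCountableTopology (PuncturedSurface.RepPIrr g p) ∧
    ∃ _ : ChartedSpace (EuclideanSpace ℝ (Fin (16 * g + 6 * p - 16)))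
        (PuncturedSurface.RepPIrr g p),
      IsManifold (𝓡 (16 * g + 6 * p - 16)) ∞ (PuncturedSurface.RepPIrr g p) ∧
      ∀ ρ : PuncturedSurface.HomPIrr g p,
        PuncturedSurface.ProjSmoothAt (d := 16 * g + 6 * p - 16) ρ ∧
        PuncturedSurface.HasSmoothLocalSectionAt (d := 16 * g + 6 * p - 16) ρ := by
  refine ⟨fun hlt => ⟨fun q => ?_⟩, PuncturedSurface.t2Space_repPIrr,
    PuncturedSurface.secondCountableTopology_repPIrr, ?_⟩
  · obtain ⟨ρ, -⟩ := PuncturedSurface.isOpenQuotientMap_proj.surjective q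
    exact absurd (PuncturedSurface.le_of_homPIrr hp ρ) (not_le.2 hlt)
  · exact PuncturedSurface.LocalSlice.exists_isManifold PuncturedSurface.isInducing_entries
      PuncturedSurface.isOpenQuotientMap_proj PuncturedSurface.exists_symmetry
      fun ρ => (PuncturedSurface.nonempty_localSlice hp ρ).some
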